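/- There is a numerical constant $C^*>0$ such that the following holds for all integers $d\ge 1$, $T\ge 2$ and all reals $\alpha,L>0$, $G\ge 0$. **Setting.** Let $\Theta\subset\mathbb{R}^d$ be a convex compact set with Euclidean diameter $B$, let $f:\mathbb{R}^d\to\mathbb{R}$ be differentiable, and let $\Theta^{\rho}=\{z:\operatorname{dist}(z,\Theta)<\rho\}$ denote the $\rho$-neighbourhood of $\Theta$. Say that $f$ is *admissible with radius $\rho>0$* if * $f$ is $\alpha$-strongly convex: $f(y)\ge f(x)+\langle\nabla f(x),y-x\rangle+\frac{\alpha}{2}\|x-y\|^2$ for all $x,y\in\mathbb{R}^d$; * $|f(z)-f(x)-\langle\nabla f(x),z-x\rangle|\le L\|z-x\|^2$ for all $x\in\Theta$ and $z\in\Theta^{\rho}$; * $f$ is Lipschitz continuous with constant $G$ on $\Theta^{\rho}$. Given $\sigma\ge 0$ and $h_t>0$, the kernel-free algorithm starts at a (possibly random) point $x_1\in\Theta$ and, for $t=1,\dots,T$, makes the queries $y_t=f(x_t+h_t\zeta_t)+\xi_t$ and $y_t'=f(x_t-h_t\zeta_t)+\xi_t'$, sets $\hat g_t=\frac{d}{2h_t}(y_t-y_t')\zeta_t$,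 and updates $x_{t+1}=\mathrm{Proj}_\Theta(x_t-\eta_t\hat g_t)$ with $\eta_t=\frac{1}{\alpha t}$, where $\mathrm{Proj}_\Theta$ is the Euclidean projection to $\Theta$. For every $t\in\{1,\dots,T\}$, the random direction $\zeta_t$ is uniformly distributed on the unit sphere of $\mathbb{R}^d$ and is independent of the pair $(x_t,\xi_t)$ and of the pair $(x_t,\xi_t')$ (this holds, for instance, if $\zeta_t$ is independent of $x_1$, of all directions and noises of earlier steps, and of the noises of step $t$), and the noises satisfy $\mathbb{E}[\xi_t^2]\le\sigma^2$ and $\mathbb{E}[(\xi_t')^2]\le\sigma^2$. The noises need not have zero mean, nor be independent of each other or across steps. **(a) Noisy case.** Let $\sigma>0$ and $h_t=\left(\frac{3d^2\sigma^2}{4L\alpha t}\right)^{1/4}$. If $f$ is admissible with radius $h_1$, then $$\forall x\in\Theta:\quad \sum_{t=1}^T\mathbb{E}[f(x_t)-f(x)]\le\min\left(GBT,\ 2\sqrt{3L}\,\sigma\frac{d}{\sqrt{\alpha}}\sqrt{T}+\frac{C^*G^2}{2}\,\frac{d}{\alpha}(1+\log T)\right).$$ **(b) Noiseless case.** Let $\sigma=0$.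 There is $\bar h>0$ depending only on $d,T,\alpha,L,G$ such that for every $\rho\in(0,\bar h]$ and every choice of $h_1,\dots,h_T\in(0,\rho]$ (for instance $\rho=h_1$ and nonincreasing $h_t$), if $f$ is admissible with radius $\rho$, then $$\forall x\in\Theta:\quad \sum_{t=1}^T\mathbb{E}[f(x_t)-f(x)]\le\min\left(GBT,\ C^*G^2\,\frac{d}{\alpha}(1+\log T)\right).$$ -/

import Mathlib

open MeasureTheory ProbabilityTheory
open scoped NNReal

/-- The uniform probability distribution on the unit sphere of `ℝ^d` (for `1 ≤ d`), as a measure on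
`ℝ^d`: the normalized surface measure. -/
noncomputable def unitSphereUniform (d : ℕ) : Measure (EuclideanSpace ℝ (Fin d)) :=
  ((volume : Measure (EuclideanSpace ℝ (Fin d))).toSphere Set.univ)⁻¹ •
    ((volume : Measure (EuclideanSpace ℝ (Fin d))).toSphere.map Subtype.val)

/-- `α`-strong convexity on `ℝ^d` of a differentiable function, in first-order form. -/
def IsStronglyConvex {d : ℕ} (α : ℝ) (f : EuclideanSpace ℝ (Fin d) → ℝ) : Prop :=
  ∀ x y : EuclideanSpace ℝ (Fin d),
    f x + inner ℝ (gradient f x) (y - x) + α / 2 * ‖x - y‖ ^ 2 ≤ f y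

/-- The class of `α`-strongly convex functions of Hölder smoothness `β = 2` with constant `L`:
`f` is differentiable and its first-order Taylor remainder is at most `L ‖z - x‖ ^ 2` for base
points `x ∈ Θ` and points `z ∈ U`. In use, `U` is a neighbourhood of `Θ` that contains all the
query points. -/
structure IsSmoothStronglyConvex {d : ℕ} (α L : ℝ) (Θ U : Set (EuclideanSpace ℝ (Fin d)))
    (f : EuclideanSpace ℝ (Fin d) → ℝ) : Prop where
  differentiable : Differentiable ℝ f
  holder : ∀ x ∈ Θ, ∀ z ∈ U,
    |f z - (f x + inner ℝ (gradient f x) (z - x))| ≤ L * ‖z - x‖ ^ 2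
  strongly_convex : IsStronglyConvex α f

/-- `p` is the Euclidean projection of `y` to `Θ`. -/
def IsEuclideanProj {d : ℕ} (Θ : Set (EuclideanSpace ℝ (Fin d)))
    (y p : EuclideanSpace ℝ (Fin d)) : Prop :=
  p ∈ Θ ∧ ∀ z ∈ Θ, ‖p - y‖ ≤ ‖z - y‖

/-- The kernel-free gradient estimate `(d / (2 h)) (y - y') ζ` at the point `x`, where
`y = f (x + h ζ) + ξ` and `y' = f (x - h ζ) + ξ'` are the two noisy queries. -/
noncomputable def gradEstimate {d : ℕ} (f : EuclideanSpace ℝ (Fin d) → ℝ) (h : ℝ)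
    (x ζ : EuclideanSpace ℝ (Fin d)) (ξ ξ' : ℝ) : EuclideanSpace ℝ (Fin d) :=
  ((d : ℝ) / (2 * h) * ((f (x + h • ζ) + ξ) - (f (x - h • ζ) + ξ'))) • ζ

/-- The kernel-free two-query projected gradient method with perturbation sizes `h t`, step sizes
`η t` and `T` steps, run with directions `ζ t`, noises `ξ t`, `ξ' t` and iterates `x t`,
`t = 1, ..., T`. The noises may have nonzero mean and depend on the past and on each other; the
direction of step `t` is independent of the current iterate together with either of the two
noises of that step. -/
structure IsKernelFreeRun {d : ℕ} {Ω : Type*} [MeasurableSpace Ω] (μ : Measure Ω)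
    (f : EuclideanSpace ℝ (Fin d) → ℝ) (Θ : Set (EuclideanSpace ℝ (Fin d)))
    (T : ℕ) (σ : ℝ) (h η : ℕ → ℝ) (x ζ : ℕ → Ω → EuclideanSpace ℝ (Fin d))
    (ξ ξ' : ℕ → Ω → ℝ) : Prop where
  measurable_init : Measurable (x 1)
  init_mem : ∀ ω, x 1 ω ∈ Θ
  step : ∀ t ∈ Finset.Icc 1 T, ∀ ω, IsEuclideanProj Θ
    (x t ω - η t • gradEstimate f (h t) (x t ω) (ζ t ω) (ξ t ω) (ξ' t ω)) (x (t + 1) ω)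
  measurable_dir : ∀ t ∈ Finset.Icc 1 T, Measurable (ζ t)
  law_dir : ∀ t ∈ Finset.Icc 1 T, μ.map (ζ t) = unitSphereUniform d
  measurable_noise : ∀ t ∈ Finset.Icc 1 T, Measurable (ξ t) ∧ Measurable (ξ' t)
  indep : ∀ t ∈ Finset.Icc 1 T, IndepFun (ζ t) (fun ω => (x t ω, ξ t ω)) μ
  indep' : ∀ t ∈ Finset.Icc 1 T, IndepFun (ζ t) (fun ω => (x t ω, ξ' t ω)) μ
  noise_bound : ∀ t ∈ Finset.Icc 1 T,
    Integrable (fun ω => ξ t ω ^ 2) μ ∧ ∫ ω, ξ t ω ^ 2 ∂μ ≤ σ ^ 2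
  noise_bound' : ∀ t ∈ Finset.Icc 1 T,
    Integrable (fun ω => ξ' t ω ^ 2) μ ∧ ∫ ω, ξ' t ω ^ 2 ∂μ ≤ σ ^ 2

/-- The perturbation sizes `(3 d² σ² / (4 L α t)) ^ (1/4)`. -/
noncomputable def perturbationSize (d : ℕ) (σ L α : ℝ) (t : ℕ) : ℝ :=
  (3 * (d : ℝ) ^ 2 * σ ^ 2 / (4 * L * α * t)) ^ (1 / 4 : ℝ)

/-- The step sizes `1 / (α t)`. -/
noncomputable def stepSize (α : ℝ) (t : ℕ) : ℝ := 1 / (α * t)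

/-- The cumulative regret of `x 1, ..., x T` against the point `p`. -/
noncomputable def cumulativeRegret {d : ℕ} {Ω : Type*} [MeasurableSpace Ω] (μ : Measure Ω)
    (f : EuclideanSpace ℝ (Fin d) → ℝ) (T : ℕ) (x : ℕ → Ω → EuclideanSpace ℝ (Fin d))
    (p : EuclideanSpace ℝ (Fin d)) : ℝ :=
  ∑ t ∈ Finset.Icc 1 T, ∫ ω, (f (x t ω) - f p) ∂μ

/-! ### The uniform law on the sphere: isometry invariance, polar coordinates, isotropy. -/

section SphereMeasure

variable {d : ℕ}

/-! The bound is the usual analysis of projected gradient steps of size 1/(αt), fed by one estimate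
for the mean of the gradient estimate and one for its second moment. Write v = x - p and let z be
uniform on the sphere.

Mean (`le_integral_sphere_mul_inner`). Morally, d/h times the average of f(x + hz)⟨z, v⟩ is the
derivative along v of f averaged over a ball of radius h. By convexity the averaged function is at
least f at x; by the Taylor bound it is at most f + Lh² at p; and it inherits strong convexity.
Hence the derivative is at least f(x) - f(p) + (α/2)‖v‖² - Lh². Instead of the divergence theorem on
the ball, the proof smooths with C¹ radial weights, lets the derivative fall on the weight, and then
concentrates the weights near radius h.

Second moment (`integral_sub_neg_sq_unitSphereUniform_le`). The trivial bound |f(x + hz) - f(x -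
hz)| ≤ 2hG would cost d²G² in the squared estimate; a Poincaré inequality saves a factor d. For (x,
y) uniform in the unit ball of E × E, the point cos θ x + sin θ y moves from x to -x as θ runs from
0 to π, and the joint law of position and velocity does not depend on θ. By Cauchy–Schwarz the
squared increment of F is on average at most π² times (DF(x)y)², and averaging over the direction of
y gives ‖∇F(x)‖²‖y‖²/d. Taking for F a degree-one homogeneous extension turns the ball integrals
into sphere integrals.

Noise. The noiseless query difference and ⟨z, v⟩ are both odd in z, and z is independent of (x, ξ)
and of (x, ξ'). So their products with a single noise have mean zero (`integral_eq_zero_of_odd`),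
whatever the mean of the noise; only the square of ξ - ξ' survives.

With a_t the mean squared distance to p, a step contributes (α/2)((t - 1)a_t - t a_{t+1}), which
telescopes. What remains is the sum of L h_t² + (C d G² + d²σ²/h_t²)/(2αt) with C = 9π²/4, to be
evaluated for the two choices of h_t. -/

theorem isProbabilityMeasure_unitSphereUniform [NeZero d] :
    IsProbabilityMeasure (unitSphereUniform d) := by
  constructor
  have h : (volume : Measure (EuclideanSpace ℝ (Fin d))).toSphere Set.univ ≠ 0 :=
    Measure.measure_univ_ne_zero.2 (Measure.toSphere_ne_zero _)
  rw [unitSphereUniform, Measure.smul_apply, Measure.map_apply measurable_subtype_coe .univ,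
    Set.preimage_univ, smul_eq_mul, ENNReal.inv_mul_cancel h (measure_ne_top _ _)]

theorem ae_norm_eq_one_unitSphereUniform :
    ∀ᵐ z ∂unitSphereUniform d, ‖z‖ = 1 := by
  refine Measure.ae_smul_measure ?_ _
  rw [ae_map_iff measurable_subtype_coe.aemeasurable (measurableSet_eq_fun (by fun_prop) (by fun_prop))]
  exact ae_of_all _ fun z => by simp

theorem integral_unitSphereUniform (H : EuclideanSpace ℝ (Fin d) → ℝ) :
    ∫ z, H z ∂unitSphereUniform d =
      ((volume : Measure (EuclideanSpace ℝ (Fin d))).toSphere.real Set.univ)⁻¹ *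
        ∫ z : Metric.sphere (0 : EuclideanSpace ℝ (Fin d)) 1, H z
          ∂(volume : Measure (EuclideanSpace ℝ (Fin d))).toSphere := by
  rw [unitSphereUniform, integral_smul_measure,
    (MeasurableEmbedding.subtype_coe (Metric.isClosed_sphere.measurableSet)).integral_map,
    smul_eq_mul, ENNReal.toReal_inv]
  rfl

-- The surface measure of a set is, up to a constant, the volume of the cone over it, and a linear
-- isometry carries cones to cones and preserves volume.
open scoped Pointwise in
theorem measurePreserving_unitSphereUniform
    (e : EuclideanSpace ℝ (Fin d) ≃ₗᵢ[ℝ] EuclideanSpace ℝ (Fin d)) :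
    MeasurePreserving e (unitSphereUniform d) (unitSphereUniform d) := by
  refine ⟨e.continuous.measurable, ?_⟩
  have key : Measure.map e ((volume : Measure (EuclideanSpace ℝ (Fin d))).toSphere.map Subtype.val)
      = (volume : Measure (EuclideanSpace ℝ (Fin d))).toSphere.map Subtype.val := by
    ext s hs
    have hs' : MeasurableSet (e ⁻¹' s) := e.continuous.measurable hs
    rw [Measure.map_apply e.continuous.measurable hs, Measure.map_apply measurable_subtype_coe hs',
      Measure.map_apply measurable_subtype_coe hs,
      Measure.toSphere_apply' _ (measurable_subtype_coe hs'),
      Measure.toSphere_apply' _ (measurable_subtype_coe hs)]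
    congr 1
    rw [← (show MeasurePreserving e.toHomeomorph.toMeasurableEquiv volume volume from
      e.measurePreserving).measure_preimage_equiv (Set.Ioo (0 : ℝ) 1 • (Subtype.val ''
        (Subtype.val ⁻¹' s : Set (Metric.sphere (0 : EuclideanSpace ℝ (Fin d)) 1))))]
    congr 1
    ext y
    change _ ↔ e y ∈ Set.Ioo (0 : ℝ) 1 • (Subtype.val ''
        (Subtype.val ⁻¹' s : Set (Metric.sphere (0 : EuclideanSpace ℝ (Fin d)) 1)))
    simp only [Set.mem_smul, Set.mem_image, Set.mem_preimage, Subtype.exists, mem_sphere_iff_norm,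
      sub_zero, exists_and_left, exists_prop, exists_eq_right_right]
    constructor
    · rintro ⟨r, hr, z, ⟨hz, hz1⟩, rfl⟩
      exact ⟨r, hr, e z, ⟨hz, by simpa using hz1⟩, by simp⟩
    · rintro ⟨r, hr, z, ⟨hz, hz1⟩, h⟩
      refine ⟨r, hr, e.symm z, ⟨by simpa using hz, by simpa using hz1⟩, ?_⟩
      apply e.injective
      simpa using h
  rw [unitSphereUniform, Measure.map_smul, key]

/-- Integration in polar coordinates. -/
theorem integral_eq_integral_radius_unitSphereUniform [NeZero d]
    {H : EuclideanSpace ℝ (Fin d) → ℝ} (hH : Integrable H) :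
    ∫ u, H u = (volume : Measure (EuclideanSpace ℝ (Fin d))).toSphere.real Set.univ *
      ∫ r in Set.Ioi (0 : ℝ), r ^ (d - 1) * ∫ z, H (r • z) ∂unitSphereUniform d := by
  set μ : Measure (EuclideanSpace ℝ (Fin d)) := volume
  have hS : μ.toSphere.real Set.univ ≠ 0 := by
    rw [Measure.real, ENNReal.toReal_ne_zero]
    exact ⟨Measure.measure_univ_ne_zero.2 (Measure.toSphere_ne_zero _), measure_ne_top _ _⟩
  have hmp := μ.measurePreserving_homeomorphUnitSphereProd
  have hdim : Module.finrank ℝ (EuclideanSpace ℝ (Fin d)) = d := by simp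
  have hsymm : ∀ p : ({(0)}ᶜ : Set (EuclideanSpace ℝ (Fin d))),
      ((homeomorphUnitSphereProd _ p).2 : ℝ) • ((homeomorphUnitSphereProd _ p).1 :
        EuclideanSpace ℝ (Fin d)) = p := by
    intro p
    exact congrArg Subtype.val ((homeomorphUnitSphereProd _).symm_apply_apply p)
  have hint : Integrable (fun q : Metric.sphere (0 : EuclideanSpace ℝ (Fin d)) 1 × Set.Ioi (0 : ℝ) =>
      H ((q.2 : ℝ) • (q.1 : EuclideanSpace ℝ (Fin d))))
      (μ.toSphere.prod (.volumeIoiPow (Module.finrank ℝ (EuclideanSpace ℝ (Fin d)) - 1))) := by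
    rw [← hmp.integrable_comp_emb (Homeomorph.measurableEmbedding _)]
    have : Integrable (fun p : ({(0)}ᶜ : Set (EuclideanSpace ℝ (Fin d))) => H p) (μ.comap (↑)) := by
      have := (integrableOn_iff_comap_subtypeVal (μ := μ) (f := H)
        (s := ({(0)}ᶜ : Set (EuclideanSpace ℝ (Fin d)))) (by measurability)).1 hH.integrableOn
      exact this
    refine this.congr (ae_of_all _ fun p => ?_)
    simp only [Function.comp_apply, hsymm]
  calc ∫ u, H u ∂μ = ∫ p : ({(0)}ᶜ : Set (EuclideanSpace ℝ (Fin d))), H p ∂(μ.comap (↑)) := by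
        rw [integral_subtype_comap (measurableSet_singleton _).compl H, restrict_compl_singleton]
    _ = ∫ q, H ((q.2 : ℝ) • (q.1 : EuclideanSpace ℝ (Fin d)))
          ∂(μ.toSphere.prod (.volumeIoiPow (Module.finrank ℝ (EuclideanSpace ℝ (Fin d)) - 1))) := by
        rw [← hmp.integral_comp (Homeomorph.measurableEmbedding _)]
        simp only [hsymm]
    _ = ∫ r : Set.Ioi (0 : ℝ), (∫ z : Metric.sphere (0 : EuclideanSpace ℝ (Fin d)) 1,
          H ((r : ℝ) • (z : EuclideanSpace ℝ (Fin d))) ∂μ.toSphere) ∂(.volumeIoiPow (d - 1)) := by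
        rw [integral_prod_symm _ hint, hdim]
    _ = ∫ r : Set.Ioi (0 : ℝ), (μ.toSphere.real Set.univ *
          ∫ z, H ((r : ℝ) • z) ∂unitSphereUniform d) ∂(.volumeIoiPow (d - 1)) := by
        congr 1
        ext r
        rw [integral_unitSphereUniform fun z => H ((r : ℝ) • z), mul_inv_cancel_left₀ hS]
    _ = _ := by
        rw [integral_const_mul]
        congr 1
        simp only [Measure.volumeIoiPow, ENNReal.ofReal]
        rw [integral_withDensity_eq_integral_smul,
          integral_subtype_comap measurableSet_Ioi fun a : ℝ =>
            Real.toNNReal (a ^ (d - 1)) • ∫ z, H (a • z) ∂unitSphereUniform d,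
          setIntegral_congr_fun measurableSet_Ioi fun x hx => ?_]
        · simp only [NNReal.smul_def, smul_eq_mul]
          rw [Real.coe_toNNReal _ (pow_nonneg (le_of_lt hx) _)]
        · exact (measurable_subtype_coe.pow_const _).real_toNNReal

/-- A measure that is invariant under linear isometries is isotropic. -/
theorem integral_inner_sq_of_isometry_invariant [NeZero d]
    {μ : Measure (EuclideanSpace ℝ (Fin d))}
    (hμ : ∀ e : EuclideanSpace ℝ (Fin d) ≃ₗᵢ[ℝ] EuclideanSpace ℝ (Fin d), MeasurePreserving e μ μ)
    (hint : Integrable (fun y => ‖y‖ ^ 2) μ) (w : EuclideanSpace ℝ (Fin d)) :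
    ∫ y, inner ℝ w y ^ 2 ∂μ = ‖w‖ ^ 2 / d * ∫ y, ‖y‖ ^ 2 ∂μ := by
  have hd : (d : ℝ) ≠ 0 := NeZero.ne _
  have hinv : ∀ a b : EuclideanSpace ℝ (Fin d), ‖a‖ = ‖b‖ →
      ∫ y, inner ℝ a y ^ 2 ∂μ = ∫ y, inner ℝ b y ^ 2 ∂μ := by
    intro a b hab
    -- Reflection in the hyperplane orthogonal to a - b swaps two vectors of equal norm, so the
    -- integral depends on w only through ‖w‖.
    set e := (ℝ ∙ (a - b))ᗮ.reflection
    have he : e a = b := Submodule.reflection_sub hab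
    rw [← (hμ e).integral_comp e.toHomeomorph.measurableEmbedding (fun y => inner ℝ b y ^ 2)]
    simp only [← he, LinearIsometryEquiv.inner_map_map]
  -- Hence w may be replaced by ‖w‖ times any coordinate vector; summing over the d choices
  -- reproduces ‖y‖².
  have hcoord : ∀ i, ∫ y, inner ℝ w y ^ 2 ∂μ = ‖w‖ ^ 2 * ∫ y : EuclideanSpace ℝ (Fin d), y i ^ 2 ∂μ := by
    intro i
    rw [hinv w (‖w‖ • EuclideanSpace.single i 1) (by simp [norm_smul]), ← integral_const_mul]
    simp [inner_smul_left, mul_pow, EuclideanSpace.inner_single_left]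
  have hsum : ∫ y, ‖y‖ ^ 2 ∂μ = ∑ i, ∫ y : EuclideanSpace ℝ (Fin d), y i ^ 2 ∂μ := by
    rw [← integral_finsetSum]
    · simp [EuclideanSpace.norm_sq_eq]
    · intro i _
      refine hint.mono' (by fun_prop) (ae_of_all _ fun y => ?_)
      rw [EuclideanSpace.norm_sq_eq, Real.norm_eq_abs, abs_of_nonneg (sq_nonneg _)]
      simpa using Finset.single_le_sum (f := fun j => ‖y j‖ ^ 2) (fun j _ => sq_nonneg _)
        (Finset.mem_univ i)
  have : (d : ℝ) * ∫ y, inner ℝ w y ^ 2 ∂μ = ‖w‖ ^ 2 * ∫ y, ‖y‖ ^ 2 ∂μ := by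
    rw [hsum, Finset.mul_sum, ← Finset.sum_congr rfl fun i _ => hcoord i]
    simp
  field_simp
  linarith

theorem integral_inner_sq_unitSphereUniform [NeZero d] (w : EuclideanSpace ℝ (Fin d)) :
    ∫ z, inner ℝ w z ^ 2 ∂unitSphereUniform d = ‖w‖ ^ 2 / d := by
  have := isProbabilityMeasure_unitSphereUniform (d := d)
  have h1 : (fun z : EuclideanSpace ℝ (Fin d) => ‖z‖ ^ 2) =ᵐ[unitSphereUniform d] fun _ => 1 := by
    filter_upwards [ae_norm_eq_one_unitSphereUniform] with z hz
    simp [hz]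
  rw [integral_inner_sq_of_isometry_invariant measurePreserving_unitSphereUniform
    ((integrable_const 1).congr h1.symm), integral_congr_ae h1]
  simp

theorem Continuous.integrable_unitSphereUniform [NeZero d] {g : EuclideanSpace ℝ (Fin d) → ℝ} (hg : Continuous g) :
    Integrable g (unitSphereUniform d) := by
  have := isProbabilityMeasure_unitSphereUniform (d := d)
  obtain ⟨M, hM⟩ := (isCompact_sphere (0 : EuclideanSpace ℝ (Fin d)) 1).exists_bound_of_continuousOn
    hg.continuousOn
  refine (integrable_const M).mono' hg.aestronglyMeasurable ?_
  filter_upwards [ae_norm_eq_one_unitSphereUniform] with z hz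
  exact hM z (by simpa using hz)

theorem measurePreserving_restrict_ball
    (e : EuclideanSpace ℝ (Fin d) ≃ₗᵢ[ℝ] EuclideanSpace ℝ (Fin d)) (R : ℝ) :
    MeasurePreserving e (volume.restrict (Metric.ball 0 R)) (volume.restrict (Metric.ball 0 R)) := by
  have := e.measurePreserving.restrict_preimage (s := Metric.ball 0 R) measurableSet_ball
  rwa [e.preimage_ball, map_zero] at this

theorem integrable_norm_sq_restrict_ball (R : ℝ) :
    Integrable (fun y : EuclideanSpace ℝ (Fin d) => ‖y‖ ^ 2) (volume.restrict (Metric.ball 0 R)) :=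
  ((by fun_prop : Continuous fun y : EuclideanSpace ℝ (Fin d) => ‖y‖ ^ 2).continuousOn.integrableOn_compact
    (isCompact_closedBall 0 R)).mono_set Metric.ball_subset_closedBall

theorem integral_inner_sq_ball [NeZero d] (w : EuclideanSpace ℝ (Fin d)) (R : ℝ) :
    ∫ y in Metric.ball 0 R, inner ℝ w y ^ 2 =
      ‖w‖ ^ 2 / d * ∫ y in Metric.ball (0 : EuclideanSpace ℝ (Fin d)) R, ‖y‖ ^ 2 :=
  integral_inner_sq_of_isometry_invariant (fun e => measurePreserving_restrict_ball e R)
    (integrable_norm_sq_restrict_ball R) w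

/-- Radius and direction separate in the integral over a centred ball. -/
theorem integral_norm_sq_mul_direction_ball [NeZero d] {g : EuclideanSpace ℝ (Fin d) → ℝ} (R : ℝ)
    (hg : IntegrableOn (fun y => ‖y‖ ^ 2 * g (‖y‖⁻¹ • y)) (Metric.ball 0 R)) :
    ∫ y in Metric.ball 0 R, ‖y‖ ^ 2 * g (‖y‖⁻¹ • y) =
      (∫ z, g z ∂unitSphereUniform d) *
        ∫ y in Metric.ball (0 : EuclideanSpace ℝ (Fin d)) R, ‖y‖ ^ 2 := by
  have := isProbabilityMeasure_unitSphereUniform (d := d)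
  have hball : MeasurableSet (Metric.ball (0 : EuclideanSpace ℝ (Fin d)) R) := measurableSet_ball
  rw [← integral_indicator hball, ← integral_indicator hball,
    integral_eq_integral_radius_unitSphereUniform ((integrable_indicator_iff hball).2 hg),
    integral_eq_integral_radius_unitSphereUniform
      ((integrable_indicator_iff hball).2 (integrable_norm_sq_restrict_ball R)),
    mul_left_comm, ← integral_const_mul (∫ z, g z ∂unitSphereUniform d)]
  congr 1
  refine setIntegral_congr_fun measurableSet_Ioi fun r hr => ?_
  replace hr : 0 < r := hr
  have hz : ∀ z : EuclideanSpace ℝ (Fin d), ‖z‖ = 1 → ‖r • z‖ = r := fun z hz => by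
    rw [norm_smul, hz, Real.norm_of_nonneg hr.le, mul_one]
  have h1 : ∫ z, (Metric.ball 0 R).indicator (fun y => ‖y‖ ^ 2 * g (‖y‖⁻¹ • y)) (r • z)
      ∂unitSphereUniform d = (if r < R then r ^ 2 else 0) * ∫ z, g z ∂unitSphereUniform d := by
    rw [← integral_const_mul]
    refine integral_congr_ae ?_
    filter_upwards [ae_norm_eq_one_unitSphereUniform] with z hz1
    simp only [Set.indicator, mem_ball_zero_iff, hz z hz1, smul_smul, inv_mul_cancel₀ hr.ne',
      one_smul]
    split_ifs <;> simp
  have h2 : ∫ z, (Metric.ball 0 R).indicator (fun y => ‖y‖ ^ 2) (r • z)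
      ∂unitSphereUniform d = if r < R then r ^ 2 else 0 := by
    rw [integral_congr_ae (g := fun _ => if r < R then r ^ 2 else 0)]
    · simp
    filter_upwards [ae_norm_eq_one_unitSphereUniform] with z hz1
    simp only [Set.indicator, mem_ball_zero_iff, hz z hz1]
  simp only [h1, h2]
  ring

end SphereMeasure

/-! ### Degree-one homogeneous extension from the sphere. -/

section RadialExtension

variable {E : Type*} [NormedAddCommGroup E] [InnerProductSpace ℝ E]

/-- The extension of a function on the unit sphere that is positively homogeneous of degree one. -/
noncomputable def radialExtension (φ : E → ℝ) (z : E) : ℝ := ‖z‖ * φ (‖z‖⁻¹ • z)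

theorem norm_smul_inv_norm_smul (z : E) : ‖z‖ • ‖z‖⁻¹ • z = z := by
  rcases eq_or_ne z 0 with rfl | hz
  · simp
  · rw [smul_smul, mul_inv_cancel₀ (norm_ne_zero_iff.2 hz), one_smul]

theorem norm_inv_norm_smul_le (z : E) : ‖‖z‖⁻¹ • z‖ ≤ 1 := by
  rw [norm_smul, norm_inv, norm_norm]
  exact inv_mul_le_one

/-- The constant 3 is 2 + 1: the change of direction, scaled by ‖z‖, is at most 2‖z - w‖, and the
change of radius is multiplied by a value of φ, which is at most K because φ vanishes at the origin.
-/
theorem lipschitzWith_radialExtension {φ : E → ℝ} {K : ℝ≥0} (h0 : φ 0 = 0)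
    (hφ : LipschitzOnWith K φ (Metric.closedBall 0 1)) :
    LipschitzWith (3 * K) (radialExtension φ) := by
  refine LipschitzWith.of_dist_le_mul fun z w => ?_
  have hu : ‖z‖⁻¹ • z ∈ Metric.closedBall (0 : E) 1 := by simpa using norm_inv_norm_smul_le z
  have ht : ‖w‖⁻¹ • w ∈ Metric.closedBall (0 : E) 1 := by simpa using norm_inv_norm_smul_le w
  have hz := norm_smul_inv_norm_smul z
  have hw := norm_smul_inv_norm_smul w
  have ht1 := norm_inv_norm_smul_le w
  unfold radialExtension
  set u := ‖z‖⁻¹ • z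
  set t := ‖w‖⁻¹ • w
  have h1 : |φ u - φ t| ≤ K * ‖u - t‖ := by
    simpa [Real.dist_eq, dist_eq_norm] using hφ.dist_le_mul _ hu _ ht
  have h2 : |φ t| ≤ K := by
    have := hφ.dist_le_mul _ ht 0 (by simp)
    rw [Real.dist_eq, h0, sub_zero, dist_zero_right] at this
    exact this.trans (mul_le_of_le_one_right K.2 ht1)
  have h3 : |‖z‖ - ‖w‖| ≤ ‖z - w‖ := abs_norm_sub_norm_le z w
  have h4 : ‖z‖ * ‖u - t‖ ≤ 2 * ‖z - w‖ := by
    have e1 : ‖z‖ * ‖u - t‖ = ‖‖z‖ • (u - t)‖ := by rw [norm_smul, norm_norm]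
    have e2 : ‖z‖ • (u - t) = (z - w) + (‖w‖ - ‖z‖) • t := by
      rw [smul_sub, sub_smul, hz, hw]; abel
    have e3 : ‖(‖w‖ - ‖z‖) • t‖ ≤ ‖z - w‖ := by
      rw [norm_smul, Real.norm_eq_abs, abs_sub_comm]
      exact (mul_le_of_le_one_right (abs_nonneg _) ht1).trans h3
    rw [e1, e2]
    linarith [norm_add_le (z - w) ((‖w‖ - ‖z‖) • t)]
  have e : ‖z‖ * φ u - ‖w‖ * φ t = ‖z‖ * (φ u - φ t) + (‖z‖ - ‖w‖) * φ t := by ring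
  rw [Real.dist_eq, e, dist_eq_norm]
  calc |‖z‖ * (φ u - φ t) + (‖z‖ - ‖w‖) * φ t|
      ≤ ‖z‖ * |φ u - φ t| + |‖z‖ - ‖w‖| * |φ t| := by
        refine (abs_add_le _ _).trans ?_
        rw [abs_mul, abs_mul, abs_norm]
    _ ≤ ‖z‖ * (K * ‖u - t‖) + ‖z - w‖ * K := by gcongr
    _ = K * (‖z‖ * ‖u - t‖) + K * ‖z - w‖ := by ring
    _ ≤ K * (2 * ‖z - w‖) + K * ‖z - w‖ := by gcongr
    _ = _ := by push_cast; ring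

theorem differentiableAt_radialExtension {φ : E → ℝ} (hφ : Differentiable ℝ φ) {z : E}
    (hz : z ≠ 0) : DifferentiableAt ℝ (radialExtension φ) z := by
  have h : DifferentiableAt ℝ (fun z : E => ‖z‖) z := (differentiableAt_id).norm ℝ hz
  exact h.mul ((hφ _).comp z ((h.inv (norm_ne_zero_iff.2 hz)).smul differentiableAt_id))

/-- Puts the squared antipodal difference in the form radius² times a function of direction, so that
its ball integral factors through the sphere. -/
theorem radialExtension_sub_radialExtension_neg (φ : E → ℝ) (z : E) :
    (radialExtension φ z - radialExtension φ (-z)) ^ 2 =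
      ‖z‖ ^ 2 * (fun u => (φ u - φ (-u)) ^ 2) (‖z‖⁻¹ • z) := by
  simp only [radialExtension, norm_neg, smul_neg]
  ring

end RadialExtension

/-! ### Rotations mixing the two factors of E × E. -/

section Rotation

variable {E : Type*} [NormedAddCommGroup E] [InnerProductSpace ℝ E]

/-- The rotation by the angle `θ` that mixes the two factors of `E × E`. -/
noncomputable def pairRotation (E : Type*) [NormedAddCommGroup E] [InnerProductSpace ℝ E] (θ : ℝ) :
    E × E →ₗ[ℝ] E × E :=
  (Real.cos θ • LinearMap.fst ℝ E E + Real.sin θ • LinearMap.snd ℝ E E).prod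
    (-Real.sin θ • LinearMap.fst ℝ E E + Real.cos θ • LinearMap.snd ℝ E E)

theorem pairRotation_apply (θ : ℝ) (p : E × E) :
    pairRotation E θ p = (Real.cos θ • p.1 + Real.sin θ • p.2,
      -Real.sin θ • p.1 + Real.cos θ • p.2) := rfl

theorem pairRotation_add (θ η : ℝ) (p : E × E) :
    pairRotation E (θ + η) p = pairRotation E θ (pairRotation E η p) := by
  simp only [pairRotation_apply, Real.cos_add, Real.sin_add, Prod.mk.injEq]
  constructor <;> module

theorem pairRotation_zero (p : E × E) : pairRotation E 0 p = p := by
  simp [pairRotation_apply]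

/-- Conjugation by (x, y) ↦ (x, -y) turns the rotation into its inverse, so both have the same
determinant, whose square is therefore 1. -/
theorem abs_det_pairRotation (θ : ℝ) : |LinearMap.det (pairRotation E θ)| = 1 := by
  have h1 : LinearMap.det (pairRotation E (-θ)) = LinearMap.det (pairRotation E θ) := by
    rw [← LinearMap.det_conj (pairRotation E θ)
      ((LinearEquiv.refl ℝ E).prodCongr (LinearEquiv.neg ℝ))]
    congr 1
    ext p <;> simp [pairRotation_apply]
  have h2 : pairRotation E θ ∘ₗ pairRotation E (-θ) = LinearMap.id := by
    refine LinearMap.ext fun p => ?_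
    rw [LinearMap.comp_apply, ← pairRotation_add, add_neg_cancel, pairRotation_zero,
      LinearMap.id_apply]
  have h3 := congrArg LinearMap.det h2
  rw [LinearMap.det_comp, h1, LinearMap.det_id] at h3
  rw [← abs_one, ← sq_eq_sq_iff_abs_eq_abs]
  linarith

end Rotation

/-! ### The rotation-invariant unit ball of E × E. -/

section PairBall

variable {E : Type*} [NormedAddCommGroup E]

/-- The Euclidean unit ball of `E × E`. -/
def pairBall (E : Type*) [NormedAddCommGroup E] : Set (E × E) := {p | ‖p.1‖ ^ 2 + ‖p.2‖ ^ 2 < 1}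

theorem isOpen_pairBall : IsOpen (pairBall E) :=
  isOpen_lt (by fun_prop) continuous_const

theorem norm_le_one_of_mem_pairBall {p : E × E} (hp : p ∈ pairBall E) : ‖p.1‖ ≤ 1 ∧ ‖p.2‖ ≤ 1 := by
  have : ‖p.1‖ ^ 2 + ‖p.2‖ ^ 2 < 1 := hp
  constructor <;> nlinarith [sq_nonneg ‖p.1‖, sq_nonneg ‖p.2‖]

theorem pairBall_subset_closedBall : pairBall E ⊆ Metric.closedBall 0 1 := fun p hp => by
  rw [mem_closedBall_zero_iff, Prod.norm_def]
  exact max_le (norm_le_one_of_mem_pairBall hp).1 (norm_le_one_of_mem_pairBall hp).2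

theorem preimage_pairRotation_pairBall [InnerProductSpace ℝ E] (θ : ℝ) : pairRotation E θ ⁻¹' pairBall E = pairBall E := by
  ext p
  simp only [pairBall, Set.mem_preimage, Set.mem_ofPred_eq, pairRotation_apply]
  have : ‖Real.cos θ • p.1 + Real.sin θ • p.2‖ ^ 2 + ‖-Real.sin θ • p.1 + Real.cos θ • p.2‖ ^ 2 =
      ‖p.1‖ ^ 2 + ‖p.2‖ ^ 2 := by
    simp only [norm_add_sq_real, norm_smul, inner_smul_left, inner_smul_right, mul_pow,
      Real.norm_eq_abs, sq_abs, conj_trivial]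
    linear_combination (‖p.1‖ ^ 2 + ‖p.2‖ ^ 2) * Real.sin_sq_add_cos_sq θ
  rw [this]

end PairBall

/-! ### Poincaré inequality for antipodal differences, by the rotation argument. -/

section SpherePoincare

variable {d : ℕ}

local notation "E" => EuclideanSpace ℝ (Fin d)

theorem measurePreserving_pairRotation (θ : ℝ) :
    MeasurePreserving (pairRotation E θ) (volume.restrict (pairBall E))
      (volume.restrict (pairBall E)) := by
  have hc : Continuous (pairRotation E θ) := LinearMap.continuous_of_finiteDimensional _
  have h : MeasurePreserving (pairRotation E θ) volume volume := by
    refine ⟨hc.measurable, ?_⟩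
    have hH : (volume : Measure (E × E)).IsAddHaarMeasure := by
      rw [Measure.volume_eq_prod]
      infer_instance
    have habs := @abs_det_pairRotation E _ _ θ
    have : LinearMap.det (pairRotation E θ) ≠ 0 := fun h => by simp [h] at habs
    rw [Measure.map_linearMap_addHaar_eq_smul_addHaar _ this, abs_inv, habs]
    simp
  have := h.restrict_preimage isOpen_pairBall.measurableSet
  rwa [preimage_pairRotation_pairBall] at this

theorem Continuous.integrable_pairBall {H : E × E → ℝ} (hH : Continuous H) :
    Integrable H (volume.restrict (pairBall E)) :=
  (hH.continuousOn.integrableOn_compact (isCompact_closedBall 0 1)).mono_set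
    pairBall_subset_closedBall

instance isFiniteMeasure_restrict_pairBall : IsFiniteMeasure (volume.restrict (pairBall E)) :=
  isFiniteMeasure_restrict.2
    ((measure_mono pairBall_subset_closedBall).trans_lt measure_closedBall_lt_top).ne

/-- The half turn from x to -x is cut into n equal rotations. Cauchy–Schwarz on the telescoping sum
costs a factor n, and by invariance of the ball the n increments have the same second moment. -/
theorem integral_sub_neg_sq_le_rotation {F : E → ℝ} (hF : Continuous F) {n : ℕ} (hn : n ≠ 0) :
    ∫ p in pairBall E, (F p.1 - F (-p.1)) ^ 2 ≤
      ∫ p in pairBall E, (n * (F (pairRotation E (Real.pi / n) p).1 - F p.1)) ^ 2 := by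
  have hc : ∀ θ, Continuous (pairRotation E θ) := fun θ => LinearMap.continuous_of_finiteDimensional _
  set δ := Real.pi / n
  set D : E × E → ℝ := fun q => (F (pairRotation E δ q).1 - F q.1) ^ 2 with hD
  have hDc : Continuous D := by
    have := hc δ
    fun_prop
  have hint : ∀ k : ℕ, ∫ p in pairBall E, D (pairRotation E (k * δ) p) = ∫ p in pairBall E, D p := by
    intro k
    have h := measurePreserving_pairRotation (d := d) (k * δ)
    rw [← integral_map h.measurable.aemeasurable, h.map_eq]
    rw [h.map_eq]
    exact hDc.aestronglyMeasurable
  have hpt : ∀ p : E × E, (F p.1 - F (-p.1)) ^ 2 ≤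
      n * ∑ k ∈ Finset.range n, D (pairRotation E (k * δ) p) := by
    intro p
    have hsum : F (-p.1) - F p.1 = ∑ k ∈ Finset.range n,
        (F (pairRotation E δ (pairRotation E (k * δ) p)).1 - F (pairRotation E (k * δ) p).1) := by
      have := Finset.sum_range_sub (fun k : ℕ => F (pairRotation E (k * δ) p).1) n
      have hnδ : (n : ℝ) * δ = Real.pi := by simp only [δ]; field_simp
      simp only [hnδ, Nat.cast_zero, zero_mul, pairRotation_zero] at this
      rw [show (pairRotation E Real.pi p).1 = -p.1 by simp [pairRotation_apply]] at this
      rw [← this]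
      refine Finset.sum_congr rfl fun k _ => ?_
      rw [← pairRotation_add]
      push_cast
      ring_nf
    rw [← neg_sub, neg_sq, hsum]
    simpa using sq_sum_le_card_mul_sum_sq (s := Finset.range n)
      (f := fun k : ℕ => F (pairRotation E δ (pairRotation E (k * δ) p)).1
        - F (pairRotation E (k * δ) p).1)
  calc ∫ p in pairBall E, (F p.1 - F (-p.1)) ^ 2
      ≤ ∫ p in pairBall E, n * ∑ k ∈ Finset.range n, D (pairRotation E (k * δ) p) := by
        refine integral_mono (Continuous.integrable_pairBall (by fun_prop))
          (Continuous.integrable_pairBall ?_) hpt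
        exact continuous_const.mul (continuous_finsetSum _ fun k _ => hDc.comp (hc _))
    _ = n * ∑ k ∈ Finset.range n, ∫ p in pairBall E, D p := by
        rw [integral_const_mul, integral_finsetSum]
        · simp only [hint]
        · exact fun k _ => Continuous.integrable_pairBall (hDc.comp (hc _))
    _ = _ := by
        rw [Finset.sum_const, Finset.card_range, nsmul_eq_mul, ← integral_const_mul,
          ← integral_const_mul]
        simp only [hD, mul_pow]
        ring_nf

theorem tendsto_mul_sub_pairRotation {F : E → ℝ} {p : E × E} (hF : DifferentiableAt ℝ F p.1) :
    Filter.Tendsto (fun n : ℕ => (n : ℝ) * (F (pairRotation E (Real.pi / n) p).1 - F p.1))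
      Filter.atTop (nhds (Real.pi * fderiv ℝ F p.1 p.2)) := by
  have h1 : HasDerivAt (fun s : ℝ => Real.cos s • p.1 + Real.sin s • p.2) p.2 0 := by
    refine (((Real.hasDerivAt_cos 0).smul_const p.1).add
      ((Real.hasDerivAt_sin 0).smul_const p.2)).congr_deriv ?_
    simp
  have h2 : HasDerivAt (fun s : ℝ => F (Real.cos s • p.1 + Real.sin s • p.2))
      (fderiv ℝ F p.1 p.2) 0 := by
    refine HasFDerivAt.comp_hasDerivAt (f := fun s : ℝ => Real.cos s • p.1 + Real.sin s • p.2)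
      (l := F) (0 : ℝ) ?_ h1
    simpa using hF.hasFDerivAt
  have h3 : Filter.Tendsto (fun n : ℕ => Real.pi / (n : ℝ)) Filter.atTop (nhdsWithin 0 {0}ᶜ) := by
    refine tendsto_nhdsWithin_iff.2 ⟨tendsto_const_div_atTop_nhds_zero_nat _, ?_⟩
    filter_upwards [Filter.eventually_gt_atTop 0] with n hn
    have := Real.pi_pos
    have : (0 : ℝ) < n := by exact_mod_cast hn
    exact (by positivity : Real.pi / (n : ℝ) ≠ 0)
  refine ((h2.tendsto_slope_zero.comp h3).const_mul Real.pi).congr' ?_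
  filter_upwards [Filter.eventually_gt_atTop 0] with n hn
  have := Real.pi_pos
  have : (0 : ℝ) < n := by exact_mod_cast hn
  simp only [Function.comp_apply, zero_add, Real.cos_zero, Real.sin_zero, one_smul, zero_smul,
    add_zero, smul_eq_mul, pairRotation_apply]
  field_simp

/-- A bound uniform in n, needed only as the dominating constant when n → ∞; with δ = π/n it comes
from |cos δ - 1| ≤ δ² and |sin δ| ≤ δ. -/
theorem abs_mul_sub_pairRotation_le {F : E → ℝ} {K : ℝ≥0} (hF : LipschitzWith K F) (n : ℕ)
    {p : E × E} (hp : p ∈ pairBall E) :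
    |(n : ℝ) * (F (pairRotation E (Real.pi / n) p).1 - F p.1)| ≤ K * (Real.pi ^ 2 + Real.pi) := by
  have hpi := Real.pi_pos
  rcases Nat.eq_zero_or_pos n with rfl | hn
  · simp only [Nat.cast_zero, zero_mul, abs_zero]
    positivity
  have hn1 : (1 : ℝ) ≤ n := by exact_mod_cast hn
  obtain ⟨hx, hy⟩ := norm_le_one_of_mem_pairBall hp
  set δ := Real.pi / n with hδ
  have hδ0 : 0 ≤ δ := by positivity
  have hnδ : n * δ = Real.pi := by rw [hδ]; field_simp
  have h1 := hF.dist_le_mul (pairRotation E δ p).1 p.1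
  have h2 : dist (pairRotation E δ p).1 p.1 ≤ δ ^ 2 + δ := by
    rw [dist_eq_norm, pairRotation_apply]
    have : Real.cos δ • p.1 + Real.sin δ • p.2 - p.1 =
        (Real.cos δ - 1) • p.1 + Real.sin δ • p.2 := by module
    simp only [this]
    have hc : |Real.cos δ - 1| ≤ δ ^ 2 := by
      rw [abs_le]
      constructor <;> nlinarith [Real.one_sub_sq_div_two_le_cos (x := δ), Real.cos_le_one δ]
    have hs : |Real.sin δ| ≤ δ := by
      simpa [abs_of_nonneg hδ0] using Real.abs_sin_le_abs (x := δ)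
    refine (norm_add_le _ _).trans (add_le_add ?_ ?_)
    · rw [norm_smul]
      exact (mul_le_of_le_one_right (norm_nonneg _) hx).trans hc
    · rw [norm_smul]
      exact (mul_le_of_le_one_right (norm_nonneg _) hy).trans hs
  rw [abs_mul, Nat.abs_cast, ← Real.dist_eq]
  calc (n : ℝ) * dist (F (pairRotation E δ p).1) (F p.1) ≤ n * (K * (δ ^ 2 + δ)) := by
        gcongr
        exact h1.trans (by gcongr)
    _ = K * (Real.pi * δ + Real.pi) := by rw [← hnδ]; ring
    _ ≤ _ := by
        have : δ ≤ Real.pi := div_le_self hpi.le hn1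
        gcongr
        nlinarith

theorem ae_pairBall_fst_ne_zero [NeZero d] : ∀ᵐ p ∂volume.restrict (pairBall E), p.1 ≠ 0 := by
  refine ae_restrict_of_ae ?_
  exact Measure.quasiMeasurePreserving_fst.ae (Measure.ae_ne volume (0 : E))

/-- The limit n → ∞ of the discrete rotation bound. Differentiability may fail at the origin, where
a radial extension has a kink, because the pairs with first component 0 form a null set. -/
theorem integral_sub_neg_sq_le_fderiv [NeZero d] {F : E → ℝ} {K : ℝ≥0} (hF : LipschitzWith K F)
    (hd : ∀ z ≠ 0, DifferentiableAt ℝ F z) :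
    ∫ p in pairBall E, (F p.1 - F (-p.1)) ^ 2 ≤
      Real.pi ^ 2 * ∫ p in pairBall E, fderiv ℝ F p.1 p.2 ^ 2 := by
  have hlim : Filter.Tendsto (fun n : ℕ => ∫ p in pairBall E,
      ((n : ℝ) * (F (pairRotation E (Real.pi / n) p).1 - F p.1)) ^ 2) Filter.atTop
      (nhds (∫ p in pairBall E, (Real.pi * fderiv ℝ F p.1 p.2) ^ 2)) := by
    refine tendsto_integral_of_dominated_convergence
      (fun _ => (K * (Real.pi ^ 2 + Real.pi)) ^ 2) (fun n => ?_) (integrable_const _)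
      (fun n => ?_) ?_
    · have hc : Continuous (pairRotation E (Real.pi / n)) :=
        LinearMap.continuous_of_finiteDimensional _
      have := hF.continuous
      exact Continuous.aestronglyMeasurable (by fun_prop)
    · filter_upwards [ae_restrict_mem isOpen_pairBall.measurableSet] with p hp
      rw [norm_pow, Real.norm_eq_abs]
      exact pow_le_pow_left₀ (abs_nonneg _) (abs_mul_sub_pairRotation_le hF n hp) 2
    · filter_upwards [ae_pairBall_fst_ne_zero] with p hp
      exact (tendsto_mul_sub_pairRotation (hd _ hp)).pow 2
  rw [← integral_const_mul]
  simp only [← mul_pow]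
  refine ge_of_tendsto hlim ?_
  filter_upwards [Filter.eventually_ne_atTop 0] with n hn
  exact integral_sub_neg_sq_le_rotation hF.continuous hn

/-- The slices are centred balls. For ‖x‖ ≥ 1 the square root is 0 by convention and the slice is
empty, as it should be. -/
theorem integral_pairBall {H : E × E → ℝ} (hH : Integrable H (volume.restrict (pairBall E))) :
    ∫ p in pairBall E, H p = ∫ x : E, ∫ y in Metric.ball (0 : E) √(1 - ‖x‖ ^ 2), H (x, y) := by
  have hD : MeasurableSet (pairBall E) := isOpen_pairBall.measurableSet
  rw [← integral_indicator hD, Measure.volume_eq_prod, integral_prod]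
  · congr 1
    ext x
    rw [← integral_indicator measurableSet_ball]
    congr 1
    ext y
    have : (x, y) ∈ pairBall E ↔ y ∈ Metric.ball (0 : E) √(1 - ‖x‖ ^ 2) := by
      rw [mem_ball_zero_iff, Real.lt_sqrt (norm_nonneg _), lt_sub_iff_add_lt, add_comm]
      rfl
    by_cases hxy : (x, y) ∈ pairBall E
    · rw [Set.indicator_of_mem hxy, Set.indicator_of_mem (this.1 hxy)]
    · rw [Set.indicator_of_notMem hxy, Set.indicator_of_notMem (mt this.2 hxy)]
  · rwa [← Measure.volume_eq_prod, integrable_indicator_iff hD]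

theorem integrable_integral_pairBall {H : E × E → ℝ}
    (hH : Integrable H (volume.restrict (pairBall E))) :
    Integrable fun x : E => ∫ y in Metric.ball (0 : E) √(1 - ‖x‖ ^ 2), H (x, y) := by
  have hD : MeasurableSet (pairBall E) := isOpen_pairBall.measurableSet
  have h : Integrable ((pairBall E).indicator H) ((volume : Measure E).prod volume) := by
    rwa [← Measure.volume_eq_prod, integrable_indicator_iff hD]
  refine h.integral_prod_left.congr (ae_of_all _ fun x => ?_)
  simp only
  rw [← integral_indicator measurableSet_ball]
  congr 1
  ext y
  have : (x, y) ∈ pairBall E ↔ y ∈ Metric.ball (0 : E) √(1 - ‖x‖ ^ 2) := by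
    rw [mem_ball_zero_iff, Real.lt_sqrt (norm_nonneg _), lt_sub_iff_add_lt, add_comm]
    rfl
  by_cases hxy : (x, y) ∈ pairBall E
  · rw [Set.indicator_of_mem hxy, Set.indicator_of_mem (this.1 hxy)]
  · rw [Set.indicator_of_notMem hxy, Set.indicator_of_notMem (mt this.2 hxy)]

theorem integral_pairBall_swap (H : E × E → ℝ) :
    ∫ p in pairBall E, H p.swap = ∫ p in pairBall E, H p := by
  have h := (Measure.measurePreserving_swap (μ := (volume : Measure E))
    (ν := (volume : Measure E))).restrict_preimage isOpen_pairBall.measurableSet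
  have hs : Prod.swap ⁻¹' pairBall E = pairBall E := by
    ext p
    simp [pairBall, add_comm]
  rw [hs] at h
  exact h.integral_comp MeasurableEquiv.prodComm.measurableEmbedding H

theorem integral_norm_sq_pairBall_pos [NeZero d] : 0 < ∫ p in pairBall E, ‖p.1‖ ^ 2 := by
  have hc : Continuous fun p : E × E => ‖p.1‖ ^ 2 := by fun_prop
  rw [integral_pos_iff_support_of_nonneg (fun p => sq_nonneg _) hc.integrable_pairBall]
  have h : (Function.support fun p : E × E => ‖p.1‖ ^ 2) =ᵐ[volume.restrict (pairBall E)]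
      Set.univ := by
    filter_upwards [ae_pairBall_fst_ne_zero] with p hp
    refine propext ⟨fun _ => trivial, fun _ => ?_⟩
    change ‖p.1‖ ^ 2 ≠ 0
    simpa using hp
  rw [measure_congr h, Measure.restrict_apply_univ]
  exact isOpen_pairBall.measure_pos _ ⟨0, by simp [pairBall]⟩

/-- The source of the factor 1/d: for fixed x the slice in y is a centred ball, hence isotropic, and
only one of d directions is seen by the gradient at x. -/
theorem integral_fderiv_sq_pairBall_le [NeZero d] {F : E → ℝ} {K : ℝ≥0} (hF : LipschitzWith K F) :
    ∫ p in pairBall E, fderiv ℝ F p.1 p.2 ^ 2 ≤ K ^ 2 / d * ∫ p in pairBall E, ‖p.2‖ ^ 2 := by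
  have hK : ∀ x, ‖fderiv ℝ F x‖ ≤ K := fun x => norm_fderiv_le_of_lipschitz ℝ hF
  have hmeas : Measurable fun p : E × E => fderiv ℝ F p.1 p.2 ^ 2 := by
    have h1 : Measurable fun p : E × E => fderiv ℝ F p.1 :=
      (measurable_fderiv ℝ F).comp measurable_fst
    have h2 : Measurable fun p : E × E => fderiv ℝ F p.1 p.2 :=
      (isBoundedBilinearMap_apply.continuous.measurable).comp (h1.prodMk measurable_snd)
    exact h2.pow_const 2
  have hint1 : Integrable (fun p : E × E => fderiv ℝ F p.1 p.2 ^ 2)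
      (volume.restrict (pairBall E)) := by
    refine (integrable_const ((K : ℝ) ^ 2)).mono' hmeas.aestronglyMeasurable ?_
    filter_upwards [ae_restrict_mem isOpen_pairBall.measurableSet] with p hp
    rw [norm_pow]
    refine pow_le_pow_left₀ (norm_nonneg _) ?_ 2
    refine ((fderiv ℝ F p.1).le_opNorm _).trans ?_
    exact (mul_le_of_le_one_right (norm_nonneg _) (norm_le_one_of_mem_pairBall hp).2).trans (hK _)
  have hint2 : Integrable (fun p : E × E => ‖p.2‖ ^ 2) (volume.restrict (pairBall E)) :=
    Continuous.integrable_pairBall (by fun_prop)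
  rw [integral_pairBall hint1, integral_pairBall hint2, ← integral_const_mul]
  refine integral_mono (integrable_integral_pairBall hint1)
    ((integrable_integral_pairBall hint2).const_mul _) fun x => ?_
  have hg : ∀ y, fderiv ℝ F x y = inner ℝ (gradient F x) y := fun y => by
    rw [gradient, InnerProductSpace.toDual_symm_apply]
  simp only [hg]
  rw [integral_inner_sq_ball]
  have : ‖gradient F x‖ ≤ K := by
    rw [gradient, LinearIsometryEquiv.norm_map]
    exact hK x
  gcongr

/-- A Poincaré inequality on the unit sphere, for antipodal differences. -/
theorem integral_sub_neg_sq_unitSphereUniform_le [NeZero d] {φ : E → ℝ} {K : ℝ≥0}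
    (hd : Differentiable ℝ φ) (hφ : LipschitzOnWith K φ (Metric.closedBall 0 1)) :
    ∫ z, (φ z - φ (-z)) ^ 2 ∂unitSphereUniform d ≤ 9 * Real.pi ^ 2 * K ^ 2 / d := by
  wlog h0 : φ 0 = 0 generalizing φ
  · have := this (φ := fun z => φ z - φ 0) (hd.sub_const _)
      (by
        refine LipschitzOnWith.of_dist_le_mul fun x hx y hy => ?_
        simpa [Real.dist_eq] using hφ.dist_le_mul x hx y hy)
      (by simp)
    simpa using this
  set F := radialExtension φ
  have hF : LipschitzWith (3 * K) F := lipschitzWith_radialExtension h0 hφ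
  have hFc := hF.continuous
  have hm := integral_norm_sq_pairBall_pos (d := d)
  have h1 := integral_sub_neg_sq_le_fderiv hF fun z hz => differentiableAt_radialExtension hd hz
  have h2 := integral_fderiv_sq_pairBall_le hF
  have h3 : ∫ p in pairBall E, ‖p.2‖ ^ 2 = ∫ p in pairBall E, ‖p.1‖ ^ 2 :=
    integral_pairBall_swap fun p : E × E => ‖p.1‖ ^ 2
  have h4 : ∫ p in pairBall E, (F p.1 - F (-p.1)) ^ 2 =
      (∫ z, (φ z - φ (-z)) ^ 2 ∂unitSphereUniform d) * ∫ p in pairBall E, ‖p.1‖ ^ 2 := by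
    -- Swapping makes the argument of F the inner variable, so that radius and direction separate on
    -- each slice with the same angular average.
    rw [← integral_pairBall_swap fun p : E × E => (F p.1 - F (-p.1)) ^ 2,
      ← integral_pairBall_swap fun p : E × E => ‖p.1‖ ^ 2, integral_pairBall, integral_pairBall,
      ← integral_const_mul]
    · congr 1
      ext x
      simp only [Prod.fst_swap, F, radialExtension_sub_radialExtension_neg]
      refine integral_norm_sq_mul_direction_ball (g := fun u => (φ u - φ (-u)) ^ 2) _ ?_
      simp only [← radialExtension_sub_radialExtension_neg]
      exact ((by fun_prop : Continuous fun z => (F z - F (-z)) ^ 2).continuousOn.integrableOn_compact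
        (isCompact_closedBall 0 _)).mono_set Metric.ball_subset_closedBall
    · exact Continuous.integrable_pairBall (by fun_prop)
    · exact Continuous.integrable_pairBall (by fun_prop)
  rw [h4] at h1
  rw [h3] at h2
  refine le_of_mul_le_mul_right ?_ hm
  calc _ ≤ _ := h1
    _ ≤ Real.pi ^ 2 * (((3 * K : ℝ≥0) : ℝ) ^ 2 / d * ∫ p in pairBall E, ‖p.1‖ ^ 2) := by gcongr
    _ = _ := by push_cast; ring

end SpherePoincare

/-! ### Radial C¹ weights with prescribed derivative profile. -/

section RadialWeight

/-- A nonnegative continuous profile `k` that vanishes from `B` on gives a radial `C¹` weight whose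
derivative is determined by `k`. -/
theorem exists_radial_weight {E : Type*} [NormedAddCommGroup E] [InnerProductSpace ℝ E]
    {k : ℝ → ℝ} (hk : Continuous k) (hk0 : ∀ s, 0 ≤ k s) {B : ℝ} (hB : ∀ s, B ≤ s → k s = 0) :
    ∃ ψ : E → ℝ, ContDiff ℝ 1 ψ ∧ (∀ u, 0 ≤ ψ u) ∧ (∀ u, B ≤ ‖u‖ ^ 2 → ψ u = 0) ∧
      (∀ u, ψ (-u) = ψ u) ∧ ∀ u v, fderiv ℝ ψ u v = -(2 * k (‖u‖ ^ 2) * inner ℝ u v) := by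
  set κ : ℝ → ℝ := fun s => ∫ t in s..B, k t
  have hκ : ∀ s, HasDerivAt κ (-k s) s := fun s =>
    intervalIntegral.integral_hasDerivAt_left (hk.intervalIntegrable _ _)
      (hk.stronglyMeasurableAtFilter _ _) hk.continuousAt
  have hκz : ∀ s, B ≤ s → κ s = 0 := fun s hs => by
    have : ∫ t in s..B, k t = ∫ t in s..B, (0 : ℝ) := by
      refine intervalIntegral.integral_congr fun t ht => ?_
      rw [Set.uIcc_of_ge hs] at ht
      exact hB t ht.1
    simpa [κ] using this
  have hκC : ContDiff ℝ 1 κ := by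
    rw [contDiff_one_iff_deriv]
    refine ⟨fun s => (hκ s).differentiableAt, ?_⟩
    rw [show deriv κ = fun s => -k s from funext fun s => (hκ s).deriv]
    exact hk.neg
  refine ⟨fun u => κ (‖u‖ ^ 2), hκC.comp (contDiff_norm_sq ℝ), fun u => ?_, fun u hu => hκz _ hu,
    fun u => by simp only [norm_neg], fun u v => ?_⟩
  · rcases le_total B (‖u‖ ^ 2) with h | h
    · exact (hκz _ h).ge
    · exact intervalIntegral.integral_nonneg h fun t _ => hk0 t
  · have h1 : HasFDerivAt (fun u : E => ‖u‖ ^ 2) (2 • innerSL ℝ u) u :=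
      (hasStrictFDerivAt_norm_sq u).hasFDerivAt
    have h2 := (hκ (‖u‖ ^ 2)).comp_hasFDerivAt u h1
    have h3 : fderiv ℝ (fun u => κ (‖u‖ ^ 2)) u = _ := h2.fderiv
    rw [h3]
    simp
    ring

theorem hasCompactSupport_of_norm_sq {E : Type*} [NormedAddCommGroup E] [ProperSpace E]
    {ψ : E → ℝ} {h : ℝ} (hh : 0 ≤ h) (hψ : ∀ u, h ^ 2 ≤ ‖u‖ ^ 2 → ψ u = 0) :
    HasCompactSupport ψ := by
  refine HasCompactSupport.intro (isCompact_closedBall 0 h) fun u hu => hψ u ?_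
  rw [mem_closedBall_zero_iff, not_le] at hu
  exact pow_le_pow_left₀ hh hu.le 2

end RadialWeight

/-! ### The mean of the gradient estimate: smoothing and localisation to the sphere. -/

section BallSmoothing

variable {d : ℕ}

local notation "E" => EuclideanSpace ℝ (Fin d)

/-- For even ψ the integral is a convolution, so the derivative falls on ψ and g need only be
continuous. -/
theorem hasDerivAt_integral_translate_mul {g ψ : E → ℝ} (hg : Continuous g) (hψ : ContDiff ℝ 1 ψ)
    (hc : HasCompactSupport ψ) (heven : ∀ u, ψ (-u) = ψ u) (x v : E) :
    HasDerivAt (fun s : ℝ => ∫ u, g (x + s • v + u) * ψ u)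
      (∫ u, g (x + u) * fderiv ℝ ψ (-u) v) 0 := by
  have h1 := hc.hasFDerivAt_convolution_right (ContinuousLinearMap.mul ℝ ℝ)
    (hg.locallyIntegrable (μ := volume)) hψ x
  have h2 : HasDerivAt (fun s : ℝ => x + s • v) v 0 := by
    simpa using ((hasDerivAt_id (0 : ℝ)).smul_const v).const_add x
  have h3 := HasFDerivAt.comp_hasDerivAt (f := fun s : ℝ => x + s • v) (0 : ℝ)
    (by simpa using h1) h2
  refine (h3.congr_deriv ?_).congr_of_eventuallyEq (Filter.Eventually.of_forall fun s => ?_)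
  · rw [convolution_precompR_apply (ContinuousLinearMap.mul ℝ ℝ) hg.locallyIntegrable
      (hc.fderiv ℝ) (hψ.continuous_fderiv one_ne_zero), convolution_def,
      ← integral_add_left_eq_self _ x]
    simp
  · simp only [Function.comp_apply, convolution_def]
    rw [← integral_add_left_eq_self
      (fun t => ContinuousLinearMap.mul ℝ ℝ (g t) (ψ (x + s • v - t))) (x + s • v)]
    simp [heven]

theorem integral_inner_mul_even {ψ : E → ℝ} (heven : ∀ u, ψ (-u) = ψ u) (w : E) :
    ∫ u, inner ℝ w u * ψ u = 0 := by
  have h := integral_neg_eq_self (fun u : E => inner ℝ w u * ψ u) volume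
  simp only [heven, inner_neg_right, neg_mul, integral_neg] at h
  linarith

/-- The first-order inequality at the intermediate point is applied towards both ends; with weights
1 - ε and ε the gradient terms cancel. -/
theorem IsStronglyConvex.segment_le {α : ℝ} {f : E → ℝ} (hf : IsStronglyConvex α f) (a v : E)
    {ε : ℝ} (h0 : 0 ≤ ε) (h1 : ε ≤ 1) :
    f (a - ε • v) ≤ (1 - ε) * f a + ε * f (a - v) - α / 2 * (ε * (1 - ε)) * ‖v‖ ^ 2 := by
  have e1 := hf (a - ε • v) a
  have e2 := hf (a - ε • v) (a - v)
  rw [show a - (a - ε • v) = ε • v by abel, show a - ε • v - a = -(ε • v) by abel, norm_neg,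
    norm_smul, inner_smul_right, mul_pow, Real.norm_eq_abs, sq_abs] at e1
  rw [show a - v - (a - ε • v) = -((1 - ε) • v) by module,
    show a - ε • v - (a - v) = (1 - ε) • v by module, inner_neg_right,
    norm_smul, inner_smul_right, mul_pow, Real.norm_eq_abs, sq_abs] at e2
  nlinarith [mul_le_mul_of_nonneg_left e1 (sub_nonneg.2 h1), mul_le_mul_of_nonneg_left e2 h0]

/-- For each u, strong convexity is used on the segment from x + u to p + u. The increment f(p + u)
- f(x + u) is bounded by the Taylor bound at p and convexity at x; the linear term ⟨w, u⟩ this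
leaves integrates to zero against an even weight. Dividing by ε → 0 will give the derivative bound.
-/
theorem integral_translate_mul_le {α L h ρ : ℝ} {Θ : Set E} {f ψ : E → ℝ} (hα : 0 ≤ α)
    (hL : 0 ≤ L) (hh : 0 < h) (hρ : h ≤ ρ)
    (hf : IsSmoothStronglyConvex α L Θ (Metric.thickening ρ Θ) f)
    (hψ : Continuous ψ) (hψ0 : ∀ u, 0 ≤ ψ u) (hψh : ∀ u, h ^ 2 ≤ ‖u‖ ^ 2 → ψ u = 0)
    (heven : ∀ u, ψ (-u) = ψ u) {x p : E} (hp : p ∈ Θ)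
    {ε : ℝ} (h0 : 0 ≤ ε) (h1 : ε ≤ 1) :
    ∫ u, f (x + (-ε) • (x - p) + u) * ψ u ≤ (∫ u, f (x + u) * ψ u) +
      (ε * (f p - f x + L * h ^ 2) - α / 2 * (ε * (1 - ε)) * ‖x - p‖ ^ 2) * ∫ u, ψ u := by
  have hc := hasCompactSupport_of_norm_sq hh.le hψh
  have hfc := hf.differentiable.continuous
  have hint : ∀ {g : E → ℝ}, Continuous g → Integrable fun u => g u * ψ u := fun hg =>
    (hg.mul hψ).integrable_of_hasCompactSupport hc.mul_left
  set w := gradient f p - gradient f x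
  set A := ε * (f p - f x + L * h ^ 2) - α / 2 * (ε * (1 - ε)) * ‖x - p‖ ^ 2
  have hpt : ∀ u, f (x + (-ε) • (x - p) + u) * ψ u ≤
      f (x + u) * ψ u + (A * ψ u + ε * (inner ℝ w u * ψ u)) := by
    intro u
    by_cases hu : h ^ 2 ≤ ‖u‖ ^ 2
    · simp [hψh u hu]
    have hun : ‖u‖ < h := lt_of_pow_lt_pow_left₀ 2 hh.le (not_le.1 hu)
    have e1 := hf.strongly_convex.segment_le (x + u) (x - p) h0 h1
    rw [show x + u - ε • (x - p) = x + (-ε) • (x - p) + u by module,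
      show x + u - (x - p) = p + u by abel] at e1
    have e2 := hf.strongly_convex x (x + u)
    rw [add_sub_cancel_left] at e2
    have e3 := le_of_abs_le (hf.holder p hp (p + u) (Metric.mem_thickening_iff.2
      ⟨p, hp, by simpa [dist_eq_norm] using hun.trans_le hρ⟩))
    rw [add_sub_cancel_left] at e3
    have e4 : α / 2 * ‖x - (x + u)‖ ^ 2 ≥ 0 := by positivity
    have e5 : L * ‖u‖ ^ 2 ≤ L * h ^ 2 := mul_le_mul_of_nonneg_left (not_le.1 hu).le hL
    have e6 : inner ℝ w u = inner ℝ (gradient f p) u - inner ℝ (gradient f x) u := inner_sub_left _ _ _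
    have e7 : f (p + u) - f (x + u) ≤ f p - f x + L * h ^ 2 + inner ℝ w u := by
      rw [e6]; linarith
    have e8 : f (x + (-ε) • (x - p) + u) ≤ f (x + u) + (A + ε * inner ℝ w u) := by
      have := mul_le_mul_of_nonneg_left e7 h0
      simp only [A]
      linarith
    nlinarith [mul_le_mul_of_nonneg_right e8 (hψ0 u)]
  have hi1 := hint (g := fun u => f (x + u)) (by fun_prop)
  have hi2 := hint (g := fun u => inner ℝ w u) (by fun_prop)
  have hi3 : Integrable ψ := hψ.integrable_of_hasCompactSupport hc
  calc _ ≤ ∫ u, f (x + u) * ψ u + (A * ψ u + ε * (inner ℝ w u * ψ u)) :=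
        integral_mono (hint (g := fun u => f (x + (-ε) • (x - p) + u)) (by fun_prop))
          (hi1.add ((hi3.const_mul _).add (hi2.const_mul _))) hpt
    _ = _ := by
        have hi4 : Integrable fun u => A * ψ u + ε * (inner ℝ w u * ψ u) :=
          (hi3.const_mul _).add (hi2.const_mul _)
        rw [integral_add hi1 hi4,
          integral_add (hi3.const_mul _) (hi2.const_mul _), integral_const_mul, integral_const_mul,
          integral_inner_mul_even heven]
        ring

theorem le_of_hasDerivAt_of_le {q : ℝ → ℝ} {q' c a : ℝ} (hq : HasDerivAt q q' 0)
    (h : ∀ ε, 0 ≤ ε → ε ≤ 1 → q (-ε) ≤ q 0 - ε * c + ε ^ 2 * a) : c ≤ q' := by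
  have h1 : Filter.Tendsto (fun ε : ℝ => ε⁻¹ • (q (-ε) - q 0)) (nhdsWithin 0 (Set.Ioi 0))
      (nhds (-q')) := by
    have : HasDerivAt (fun ε => q (-ε)) (-q') 0 := by
      have h2 : HasDerivAt q q' (-0) := by simpa using hq
      exact (HasDerivAt.comp (h₂ := q) (0 : ℝ) h2 (hasDerivAt_neg (0 : ℝ))).congr_deriv (by ring)
    simpa using this.tendsto_slope_zero_right
  have h2 : Filter.Tendsto (fun ε : ℝ => -c + ε * a) (nhdsWithin 0 (Set.Ioi 0)) (nhds (-c)) := by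
    have : Continuous fun ε : ℝ => -c + ε * a := by fun_prop
    simpa using (this.tendsto 0).mono_left nhdsWithin_le_nhds
  refine neg_le_neg_iff.1 (le_of_tendsto_of_tendsto h1 h2 ?_)
  filter_upwards [Ioo_mem_nhdsGT (show (0 : ℝ) < 1 by norm_num)] with ε hε
  have := h ε hε.1.le hε.2.le
  rw [smul_eq_mul, inv_mul_le_iff₀ hε.1]
  linarith

/-- Weighted form of the bias bound: the derivative of a radially smoothed strongly convex
function dominates the increment of the function. -/
theorem integral_mul_inner_profile_nonneg {α L h ρ b : ℝ} {Θ : Set E} {f : E → ℝ} (hα : 0 ≤ α)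
    (hL : 0 ≤ L) (hh : 0 < h) (hρ : h ≤ ρ)
    (hf : IsSmoothStronglyConvex α L Θ (Metric.thickening ρ Θ) f)
    {x p : E} (hp : p ∈ Θ)
    (hb : b * ‖x - p‖ ^ 2 = f x - f p + α / 2 * ‖x - p‖ ^ 2 - L * h ^ 2)
    {k : ℝ → ℝ} (hk : Continuous k) (hk0 : ∀ s, 0 ≤ k s) (hkh : ∀ s, h ^ 2 ≤ s → k s = 0) :
    0 ≤ ∫ u, (f (x + u) - b * inner ℝ u (x - p)) * k (‖u‖ ^ 2) * inner ℝ u (x - p) := by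
  obtain ⟨ψ, hψC, hψ0, hψh, heven, hψd⟩ := @exists_radial_weight E _ _ _ hk hk0 _ hkh
  have hc : HasCompactSupport ψ := hasCompactSupport_of_norm_sq hh.le hψh
  have hψc := hψC.continuous
  have hfc := hf.differentiable.continuous
  set v := x - p with hv
  have hi3 : Integrable ψ := hψc.integrable_of_hasCompactSupport hc
  have hck : HasCompactSupport fun u : E => k (‖u‖ ^ 2) :=
    hasCompactSupport_of_norm_sq hh.le fun u hu => hkh _ hu
  have hint : ∀ {g : E → ℝ}, Continuous g → Integrable fun u => g u * k (‖u‖ ^ 2) := fun hg =>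
    (hg.mul (by fun_prop)).integrable_of_hasCompactSupport hck.mul_left
  have hd : ∀ u, fderiv ℝ ψ (-u) v = 2 * k (‖u‖ ^ 2) * inner ℝ u v := fun u => by
    rw [hψd, norm_neg, inner_neg_left]; ring
  have h1 := hasDerivAt_integral_translate_mul hfc hψC hc heven x v
  -- The derivative formula for a linear function evaluates the normalisation: the integral of
  -- 2k(‖u‖²)⟨u, v⟩² is ‖v‖² times the mass of ψ.
  have h2 := hasDerivAt_integral_translate_mul (g := fun u => inner ℝ v u) (by fun_prop)
    hψC hc heven 0 v
  simp only [hd] at h1 h2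
  have h3 : (fun s : ℝ => ∫ u, inner ℝ v (0 + s • v + u) * ψ u) =
      fun s => s * (‖v‖ ^ 2 * ∫ u, ψ u) := by
    ext s
    simp only [zero_add, inner_add_right, inner_smul_right, real_inner_self_eq_norm_sq, add_mul]
    rw [integral_add (hi3.const_mul _)
      ((show Continuous fun u => inner ℝ v u * ψ u by fun_prop).integrable_of_hasCompactSupport
        hc.mul_left), integral_inner_mul_even heven, integral_const_mul]
    ring
  rw [h3] at h2
  have h4 := h2.unique ((hasDerivAt_id (0 : ℝ)).mul_const _)
  have h5 : (b * ‖v‖ ^ 2) * (∫ u, ψ u) ≤ ∫ u, f (x + u) * (2 * k (‖u‖ ^ 2) * inner ℝ u v) := by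
    refine le_of_hasDerivAt_of_le (a := α / 2 * ‖v‖ ^ 2 * ∫ u, ψ u) h1 fun ε e0 e1 => ?_
    refine (integral_translate_mul_le hα hL hh hρ hf hψc hψ0 hψh heven hp e0 e1).trans (le_of_eq ?_)
    rw [hb]
    simp only [zero_smul, add_zero]
    ring
  have h6 : ∫ u, (f (x + u) - b * inner ℝ u v) * k (‖u‖ ^ 2) * inner ℝ u v =
      2⁻¹ * ((∫ u, f (x + u) * (2 * k (‖u‖ ^ 2) * inner ℝ u v)) -
        b * ∫ u, inner ℝ v (0 + u) * (2 * k (‖u‖ ^ 2) * inner ℝ u v)) := by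
    rw [← integral_const_mul b, ← integral_sub, ← integral_const_mul]
    · congr 1
      ext u
      rw [zero_add, real_inner_comm v u]
      ring
    · exact (hint (g := fun u => f (x + u) * (2 * inner ℝ u v)) (by fun_prop)).congr
        (ae_of_all _ fun u => by ring)
    · exact (hint (g := fun u => b * (inner ℝ v (0 + u) * (2 * inner ℝ u v))) (by fun_prop)).congr
        (ae_of_all _ fun u => by ring)
  rw [h6, h4]
  linarith

theorem continuous_integral_sphere [NeZero d] {g : E → ℝ} (hg : Continuous g) (v : E) :
    Continuous fun r : ℝ => ∫ z, g (r • z) * inner ℝ z v ∂unitSphereUniform d := by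
  have := isProbabilityMeasure_unitSphereUniform (d := d)
  have hr : (unitSphereUniform d).restrict (Metric.sphere 0 1) = unitSphereUniform d := by
    refine Measure.restrict_eq_self_of_ae_mem ?_
    filter_upwards [ae_norm_eq_one_unitSphereUniform] with z hz
    simpa using hz
  rw [← hr]
  exact continuous_parametric_integral_of_continuous (by fun_prop) (isCompact_sphere 0 1)

/-- Passes from all radial profiles to the single radius h. If the spherical average were negative
at h, by continuity it would be negative on some [a, h], and a profile living on that interval would
give a negative weighted integral. -/
theorem integral_sphere_mul_inner_nonneg [NeZero d] {g : E → ℝ} (hg : Continuous g) (v : E) {h : ℝ}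
    (hh : 0 < h)
    (hpos : ∀ k : ℝ → ℝ, Continuous k → (∀ s, 0 ≤ k s) → (∀ s, h ^ 2 ≤ s → k s = 0) →
      0 ≤ ∫ u, g u * k (‖u‖ ^ 2) * inner ℝ u v) :
    0 ≤ ∫ z, g (h • z) * inner ℝ z v ∂unitSphereUniform d := by
  set A : ℝ → ℝ := fun r => ∫ z, g (r • z) * inner ℝ z v ∂unitSphereUniform d with hA
  have hAc : Continuous A := continuous_integral_sphere hg v
  set S := (volume : Measure E).toSphere.real Set.univ
  have hS : 0 < S := by
    exact ENNReal.toReal_pos (Measure.measure_univ_ne_zero.2 (Measure.toSphere_ne_zero _))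
      (measure_ne_top _ _)
  by_contra hneg
  have hAh : A h < 0 := not_le.1 hneg
  obtain ⟨δ, hδ, hball⟩ := Metric.isOpen_iff.1 (isOpen_lt hAc continuous_const) h hAh
  obtain ⟨a, ha0, hah, haδ⟩ : ∃ a, 0 < a ∧ a < h ∧ h - δ < a := by
    refine ⟨max (h / 2) (h - δ / 2), ?_, ?_, ?_⟩
    · exact lt_max_of_lt_left (by linarith)
    · exact max_lt (by linarith) (by linarith)
    · exact lt_max_of_lt_right (by linarith)
  have hAneg : ∀ r, a ≤ r → r ≤ h → A r < 0 := fun r h1 h2 => hball (by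
    rw [Metric.mem_ball, Real.dist_eq, abs_lt]
    constructor <;> linarith)
  set k : ℝ → ℝ := fun s => max 0 ((√s - a) * (h - √s)) with hk
  have hkc : Continuous k := by fun_prop
  have hk1 : ∀ s, h ^ 2 ≤ s → k s = 0 := fun s hs => by
    have : h ≤ √s := Real.le_sqrt_of_sq_le hs
    exact max_eq_left (mul_nonpos_of_nonneg_of_nonpos (by linarith) (by linarith))
  have h0 := hpos k hkc (fun s => le_max_left _ _) hk1
  have hck : HasCompactSupport fun u : E => k (‖u‖ ^ 2) :=
    hasCompactSupport_of_norm_sq hh.le fun u hu => hk1 _ hu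
  have hint : Integrable fun u : E => g u * k (‖u‖ ^ 2) * inner ℝ u v := by
    refine Continuous.integrable_of_hasCompactSupport (by fun_prop) ?_
    exact (hck.mul_left (f := g)).mul_right
  rw [integral_eq_integral_radius_unitSphereUniform hint] at h0
  -- The power r ^ d collects the polar Jacobian r ^ (d - 1) and the factor r from ⟨rz, v⟩; the
  -- minus sign makes N nonnegative.
  set N : ℝ → ℝ := fun r => -(r ^ d * max 0 ((r - a) * (h - r)) * A r) with hN
  have hinner : ∀ r ∈ Set.Ioi (0 : ℝ), r ^ (d - 1) *
      ∫ z, g (r • z) * k (‖r • z‖ ^ 2) * inner ℝ (r • z) v ∂unitSphereUniform d = -N r := by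
    intro r hr
    replace hr : 0 < r := hr
    have hz : ∫ z, g (r • z) * k (‖r • z‖ ^ 2) * inner ℝ (r • z) v ∂unitSphereUniform d =
        (max 0 ((r - a) * (h - r)) * r) * A r := by
      rw [hA]
      simp only
      rw [← integral_const_mul]
      refine integral_congr_ae ?_
      filter_upwards [ae_norm_eq_one_unitSphereUniform] with z hz
      simp only [hk, norm_smul, hz, mul_one, inner_smul_left, conj_trivial]
      rw [Real.norm_of_nonneg hr.le, Real.sqrt_sq hr.le]
      ring
    rw [hz]
    simp only [hN]
    have hd : r ^ d = r ^ (d - 1) * r := by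
      rw [← pow_succ, Nat.sub_add_cancel (NeZero.one_le)]
    rw [hd]
    ring
  have hzero : ∀ r, (r < a ∨ h < r) → max 0 ((r - a) * (h - r)) = 0 := by
    rintro r (hr | hr)
    · exact max_eq_left (mul_nonpos_of_nonpos_of_nonneg (by linarith) (by linarith))
    · exact max_eq_left (mul_nonpos_of_nonneg_of_nonpos (by linarith) (by linarith))
  have hNz : ∀ r, (r < a ∨ h < r) → N r = 0 := fun r hr => by simp [hN, hzero r hr]
  have hNpos : 0 < ∫ r, N r := by
    refine Continuous.integral_pos_of_hasCompactSupport_nonneg_nonzero (x := (a + h) / 2)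
      (by fun_prop) ?_ ?_ ?_
    · refine HasCompactSupport.intro (isCompact_Icc (a := a) (b := h)) fun r hr => hNz r ?_
      by_contra hcon
      push Not at hcon
      exact hr hcon
    · intro r
      by_cases hr : r < a ∨ h < r
      · exact (hNz r hr).ge
      · push Not at hr
        have h1 := hAneg r hr.1 hr.2
        have h2 : 0 ≤ r ^ d * max 0 ((r - a) * (h - r)) :=
          mul_nonneg (pow_nonneg (by linarith) _) (le_max_left _ _)
        simp only [hN, Pi.zero_apply]
        nlinarith
    · have h1 := hAneg ((a + h) / 2) (by linarith) (by linarith)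
      have h2 : 0 < ((a + h) / 2 - a) * (h - (a + h) / 2) :=
        mul_pos (by linarith) (by linarith)
      have h3 : 0 < ((a + h) / 2) ^ d := pow_pos (by linarith) _
      simp only [hN]
      rw [max_eq_right h2.le]
      exact neg_ne_zero.2 (mul_ne_zero (mul_pos h3 h2).ne' h1.ne)
  rw [setIntegral_congr_fun measurableSet_Ioi hinner, integral_neg,
    setIntegral_eq_integral_of_forall_compl_eq_zero] at h0
  · nlinarith
  · intro r hr
    exact hNz r (Or.inl ((not_lt.1 hr).trans_lt ha0))

/-- The two-point gradient estimate dominates the increments of a strongly convex function up to a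
smoothing error. -/
theorem le_integral_sphere_mul_inner [NeZero d] {α L h ρ : ℝ} {Θ : Set E} {f : E → ℝ} (hα : 0 ≤ α)
    (hL : 0 ≤ L) (hh : 0 < h) (hρ : h ≤ ρ)
    (hf : IsSmoothStronglyConvex α L Θ (Metric.thickening ρ Θ) f) {x p : E} (hp : p ∈ Θ) :
    f x - f p + α / 2 * ‖x - p‖ ^ 2 - L * h ^ 2 ≤
      d / h * ∫ z, f (x + h • z) * inner ℝ z (x - p) ∂unitSphereUniform d := by
  have hd : (0 : ℝ) < d := by exact_mod_cast NeZero.pos d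
  rcases eq_or_ne x p with rfl | hxp
  · simp only [sub_self, inner_zero_right, mul_zero, integral_zero, norm_zero]
    have : 0 ≤ L * h ^ 2 := by positivity
    norm_num
    linarith
  have hv : 0 < ‖x - p‖ ^ 2 := by
    have := norm_pos_iff.2 (sub_ne_zero.2 hxp)
    positivity
  set c := f x - f p + α / 2 * ‖x - p‖ ^ 2 - L * h ^ 2 with hc
  -- The linear function u ↦ b⟨u, x - p⟩ has derivative exactly c along x - p. Subtracting it turns
  -- the comparison into a sign statement, which localises to the sphere.
  set b := c / ‖x - p‖ ^ 2 with hb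
  have hbc : b * ‖x - p‖ ^ 2 = c := div_mul_cancel₀ _ hv.ne'
  have hfc := hf.differentiable.continuous
  have h1 := integral_sphere_mul_inner_nonneg (g := fun u => f (x + u) - b * inner ℝ u (x - p))
    (by fun_prop) (x - p) hh fun k hk hk0 hkh =>
      integral_mul_inner_profile_nonneg hα hL hh hρ hf hp hbc hk hk0 hkh
  have h2 : ∫ z, (f (x + h • z) - b * inner ℝ (h • z) (x - p)) * inner ℝ z (x - p)
      ∂unitSphereUniform d = (∫ z, f (x + h • z) * inner ℝ z (x - p) ∂unitSphereUniform d) -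
        b * h * (‖x - p‖ ^ 2 / d) := by
    rw [← integral_inner_sq_unitSphereUniform, ← integral_const_mul, ← integral_sub]
    · congr 1
      ext z
      rw [inner_smul_left, conj_trivial, real_inner_comm z (x - p)]
      ring
    · exact Continuous.integrable_unitSphereUniform (by fun_prop)
    · exact Continuous.integrable_unitSphereUniform (by fun_prop)
  rw [h2] at h1
  have h3 : b * h * (‖x - p‖ ^ 2 / d) = h / d * c := by rw [← hbc]; ring
  rw [h3] at h1
  calc c = d / h * (h / d * c) := by field_simp
    _ ≤ _ := by
      refine mul_le_mul_of_nonneg_left (by linarith) (by positivity)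

end BallSmoothing

/-! ### Euclidean projection to a convex set. -/

section Projection

variable {d : ℕ}

local notation "E" => EuclideanSpace ℝ (Fin d)

theorem IsEuclideanProj.inner_le_zero {Θ : Set E} (hΘ : Convex ℝ Θ) {y p z : E}
    (hp : IsEuclideanProj Θ y p) (hz : z ∈ Θ) : inner ℝ (y - p) (z - p) ≤ 0 := by
  have : Nonempty Θ := ⟨⟨p, hp.1⟩⟩
  refine (norm_eq_iInf_iff_real_inner_le_zero hΘ hp.1).1 (le_antisymm ?_ ?_) z hz
  · refine le_ciInf fun w => ?_
    rw [norm_sub_rev y p, norm_sub_rev y w]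
    exact hp.2 w w.2
  · exact ciInf_le ⟨0, by rintro _ ⟨w, rfl⟩; exact norm_nonneg _⟩ (⟨p, hp.1⟩ : Θ)

theorem IsEuclideanProj.norm_sub_le {Θ : Set E} (hΘ : Convex ℝ Θ) {y y' p p' : E}
    (hp : IsEuclideanProj Θ y p) (hp' : IsEuclideanProj Θ y' p') : ‖p - p'‖ ≤ ‖y - y'‖ := by
  have h1 := hp.inner_le_zero hΘ hp'.1
  have h2 := hp'.inner_le_zero hΘ hp.1
  have h3 : ‖p - p'‖ ^ 2 ≤ inner ℝ (y - y') (p - p') := by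
    rw [← real_inner_self_eq_norm_sq]
    have e1 : inner ℝ (y - p) (p' - p) = -inner ℝ (y - p) (p - p') := by
      rw [← inner_neg_right, neg_sub]
    have e2 : inner ℝ (y - y') (p - p') = inner ℝ (y - p) (p - p') + inner ℝ (p - p') (p - p') -
        inner ℝ (y' - p') (p - p') := by
      rw [← inner_add_left, ← inner_sub_left]
      congr 1
      abel
    linarith
  have h4 := h3.trans (real_inner_le_norm _ _)
  rcases (norm_nonneg (p - p')).eq_or_lt with h | h
  · rw [← h]; exact norm_nonneg _
  · rw [sq] at h4
    exact le_of_mul_le_mul_right h4 h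

theorem isEuclideanProj_self {Θ : Set E} {z : E} (hz : z ∈ Θ) : IsEuclideanProj Θ z z :=
  ⟨hz, fun w _ => by simp⟩

theorem exists_lipschitzWith_isEuclideanProj {Θ : Set E} (hΘ : Convex ℝ Θ) (hc : IsCompact Θ)
    (hne : Θ.Nonempty) : ∃ P : E → E, LipschitzWith 1 P ∧ ∀ y, IsEuclideanProj Θ y (P y) := by
  have h : ∀ y, ∃ p, IsEuclideanProj Θ y p := fun y => by
    obtain ⟨p, hp, hmin⟩ := hc.exists_isMinOn hne
      (show ContinuousOn (fun z => ‖z - y‖) Θ by fun_prop)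
    exact ⟨p, hp, fun z hz => hmin hz⟩
  choose P hP using h
  refine ⟨P, LipschitzWith.of_dist_le_mul fun y y' => ?_, hP⟩
  simpa [dist_eq_norm] using (hP y).norm_sub_le hΘ (hP y')

/-- Projections are unique and nonexpansive, so X is a continuous function of Y. -/
theorem measurable_of_isEuclideanProj {Ω : Type*} [MeasurableSpace Ω] {Θ : Set E}
    (hΘ : Convex ℝ Θ) (hc : IsCompact Θ) (hne : Θ.Nonempty) {Y X : Ω → E} (hY : Measurable Y)
    (hX : ∀ ω, IsEuclideanProj Θ (Y ω) (X ω)) : Measurable X := by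
  obtain ⟨P, hP, hproj⟩ := exists_lipschitzWith_isEuclideanProj hΘ hc hne
  have : X = P ∘ Y := funext fun ω => by
    have := (hX ω).norm_sub_le hΘ (hproj (Y ω))
    rw [sub_self, norm_zero] at this
    exact sub_eq_zero.1 (norm_le_zero_iff.1 this)
  rw [this]
  exact hP.continuous.measurable.comp hY

theorem norm_sub_sq_le_of_isEuclideanProj {Θ : Set E} (hΘ : Convex ℝ Θ) {x g x' p : E} {η : ℝ}
    (hp : p ∈ Θ) (hx' : IsEuclideanProj Θ (x - η • g) x') :
    ‖x' - p‖ ^ 2 ≤ ‖x - p‖ ^ 2 - 2 * η * inner ℝ g (x - p) + η ^ 2 * ‖g‖ ^ 2 := by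
  have h := hx'.norm_sub_le hΘ (isEuclideanProj_self hp)
  have h2 := pow_le_pow_left₀ (norm_nonneg _) h 2
  rw [show x - η • g - p = (x - p) - η • g by abel, norm_sub_sq_real (x - p), inner_smul_right, norm_smul,
    mul_pow, Real.norm_eq_abs, sq_abs, real_inner_comm] at h2
  linarith

end Projection

/-! ### Averaging over an independent direction. -/

section Independence

variable {d : ℕ} {Ω : Type*} [MeasurableSpace Ω] {μ : Measure Ω} [IsProbabilityMeasure μ]

local notation "E" => EuclideanSpace ℝ (Fin d)

theorem measurePreserving_neg_unitSphereUniform :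
    MeasurePreserving (fun z : E => -z) (unitSphereUniform d) (unitSphereUniform d) :=
  measurePreserving_unitSphereUniform (LinearIsometryEquiv.neg ℝ)

/-- A direction-odd function of an independent pair has mean zero. -/
theorem integral_eq_zero_of_odd [NeZero d] {F : Type*} [MeasurableSpace F] {ζ : Ω → E} {W : Ω → F}
    (hζ : Measurable ζ) (hW : Measurable W) (hlaw : μ.map ζ = unitSphereUniform d)
    (hind : IndepFun ζ W μ) {k : E × F → ℝ} (hk : Measurable k)
    (hodd : ∀ z w, k (-z, w) = -k (z, w)) : ∫ ω, k (ζ ω, W ω) ∂μ = 0 := by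
  have := isProbabilityMeasure_unitSphereUniform (d := d)
  have := Measure.isProbabilityMeasure_map (μ := μ) hW.aemeasurable
  have hmap := (indepFun_iff_map_prod_eq_prod_map_map hζ.aemeasurable hW.aemeasurable).1 hind
  rw [hlaw] at hmap
  have h1 : ∫ ω, k (ζ ω, W ω) ∂μ = ∫ q, k q ∂(unitSphereUniform d).prod (μ.map W) := by
    rw [← hmap, integral_map (hζ.prodMk hW).aemeasurable hk.aestronglyMeasurable]
  -- Flipping the direction alone preserves the product law, so the integral equals its own
  -- negative.
  have hmp := (measurePreserving_neg_unitSphereUniform (d := d)).prod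
    (MeasurePreserving.id (μ.map W))
  have h2 : ∫ q, k q ∂(unitSphereUniform d).prod (μ.map W) =
      ∫ q, k (Prod.map (fun z : E => -z) id q) ∂(unitSphereUniform d).prod (μ.map W) := by
    rw [← integral_map hmp.measurable.aemeasurable hk.aestronglyMeasurable, hmp.map_eq]
  simp only [Prod.map_apply', id, hodd, integral_neg] at h2
  rw [h1]
  change _ = -∫ q, k q ∂_ at h2
  linarith

/-- Averaging over an independent direction first. -/
theorem integral_le_integral_of_le_integral_direction [NeZero d] {F : Type*} [MeasurableSpace F]
    {ζ : Ω → E} {W : Ω → F} (hζ : Measurable ζ) (hW : Measurable W)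
    (hlaw : μ.map ζ = unitSphereUniform d) (hind : IndepFun ζ W μ) {k : E × F → ℝ}
    (hk : Measurable k) (hint : Integrable (fun ω => k (ζ ω, W ω)) μ) {m : Ω → ℝ}
    (hm : Integrable m μ) (hle : ∀ ω, m ω ≤ ∫ z, k (z, W ω) ∂unitSphereUniform d) :
    ∫ ω, m ω ∂μ ≤ ∫ ω, k (ζ ω, W ω) ∂μ := by
  have := isProbabilityMeasure_unitSphereUniform (d := d)
  have := Measure.isProbabilityMeasure_map (μ := μ) hW.aemeasurable
  have hmap := (indepFun_iff_map_prod_eq_prod_map_map hζ.aemeasurable hW.aemeasurable).1 hind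
  rw [hlaw] at hmap
  have hkint : Integrable k ((unitSphereUniform d).prod (μ.map W)) := by
    rw [← hmap]
    exact (integrable_map_measure hk.aestronglyMeasurable (hζ.prodMk hW).aemeasurable).2 hint
  have h1 : ∫ ω, k (ζ ω, W ω) ∂μ = ∫ ω, ∫ z, k (z, W ω) ∂unitSphereUniform d ∂μ := by
    rw [← integral_map (φ := fun ω => (ζ ω, W ω)) (f := k) (hζ.prodMk hW).aemeasurable
      hk.aestronglyMeasurable, hmap,
      integral_prod_symm _ hkint, integral_map hW.aemeasurable]
    exact hkint.integral_prod_right.aestronglyMeasurable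
  rw [h1]
  exact integral_mono hm ((integrable_map_measure hkint.integral_prod_right.aestronglyMeasurable
    hW.aemeasurable).1 hkint.integral_prod_right) hle

end Independence

/-! ### Mean and second moment of the noiseless query difference. -/

section Difference

variable {d : ℕ}

local notation "E" => EuclideanSpace ℝ (Fin d)

/-- Since h = ρ is allowed, queries may fall on the boundary of the open neighbourhood; continuity
extends the Lipschitz bound to the closed ball. -/
theorem lipschitzOnWith_closedBall_of_thickening {f : E → ℝ} {G : ℝ≥0} {Θ : Set E} {ρ h : ℝ}
    (hf : Continuous f) (hG : LipschitzOnWith G f (Metric.thickening ρ Θ)) (hh : h ≠ 0)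
    (hρ : h ≤ ρ) {x : E} (hx : x ∈ Θ) : LipschitzOnWith G f (Metric.closedBall x h) := by
  have h1 : LipschitzOnWith G f (Metric.ball x h) := hG.mono fun y hy =>
    Metric.mem_thickening_iff.2 ⟨x, hx, (Metric.mem_ball.1 hy).trans_le hρ⟩
  rw [← closure_ball x hh]
  exact LipschitzOnWith.closure hf.continuousOn h1

theorem lipschitzOnWith_comp_add_smul {f : E → ℝ} {G h : ℝ≥0} {x : E}
    (hf : LipschitzOnWith G f (Metric.closedBall x h)) :
    LipschitzOnWith (h * G) (fun z => f (x + (h : ℝ) • z)) (Metric.closedBall 0 1) := by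
  refine LipschitzOnWith.of_dist_le_mul fun z hz w hw => ?_
  have hmem : ∀ z ∈ Metric.closedBall (0 : E) 1, x + (h : ℝ) • z ∈ Metric.closedBall x h := by
    intro z hz
    rw [mem_closedBall_zero_iff] at hz
    rw [mem_closedBall_iff_norm, add_sub_cancel_left, norm_smul, Real.norm_of_nonneg h.coe_nonneg]
    exact mul_le_of_le_one_right h.2 hz
  refine (hf.dist_le_mul _ (hmem z hz) _ (hmem w hw)).trans (le_of_eq ?_)
  rw [dist_add_left, dist_smul₀, Real.norm_of_nonneg h.coe_nonneg]
  push_cast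
  ring

/-- The noiseless difference of the two queries. -/
noncomputable def queryDifference (f : E → ℝ) (h : ℝ) (x z : E) : ℝ := f (x + h • z) - f (x - h • z)

theorem queryDifference_neg (f : E → ℝ) (h : ℝ) (x z : E) :
    queryDifference f h x (-z) = -queryDifference f h x z := by
  simp [queryDifference, sub_eq_add_neg]

theorem continuous_queryDifference {f : E → ℝ} (hf : Continuous f) (h : ℝ) :
    Continuous fun q : E × E => queryDifference f h q.1 q.2 := by
  unfold queryDifference
  fun_prop

theorem abs_queryDifference_le {f : E → ℝ} {G : ℝ≥0} {h : ℝ} (hh : 0 ≤ h) {x z : E}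
    (hf : LipschitzOnWith G f (Metric.closedBall x h)) (hz : ‖z‖ = 1) :
    |queryDifference f h x z| ≤ 2 * h * G := by
  have h1 := hf.dist_le_mul (x + h • z) (by simp [norm_smul, hz, abs_of_nonneg hh])
    (x - h • z) (by simp [norm_smul, hz, abs_of_nonneg hh])
  rw [Real.dist_eq, dist_eq_norm, show x + h • z - (x - h • z) = (2 * h) • z by module,
    norm_smul, hz, Real.norm_of_nonneg (by positivity)] at h1
  unfold queryDifference
  linarith

theorem integral_queryDifference_sq_le [NeZero d] {f : E → ℝ} {G : ℝ≥0} {h : ℝ} (hh : 0 ≤ h) {x : E}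
    (hd : Differentiable ℝ f) (hf : LipschitzOnWith G f (Metric.closedBall x h)) :
    ∫ z, queryDifference f h x z ^ 2 ∂unitSphereUniform d ≤
      9 * Real.pi ^ 2 * (h * G) ^ 2 / d := by
  lift h to ℝ≥0 using hh
  have h1 := integral_sub_neg_sq_unitSphereUniform_le
    (φ := fun z => f (x + (h : ℝ) • z)) (by fun_prop) (lipschitzOnWith_comp_add_smul hf)
  simpa [queryDifference, sub_eq_add_neg] using h1

theorem integral_queryDifference_mul_inner [NeZero d] {f : E → ℝ} (hf : Continuous f) (h : ℝ)
    (x v : E) :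
    ∫ z, queryDifference f h x z * inner ℝ z v ∂unitSphereUniform d =
      2 * ∫ z, f (x + h • z) * inner ℝ z v ∂unitSphereUniform d := by
  have h1 : ∫ z, f (x - h • z) * inner ℝ z v ∂unitSphereUniform d =
      -∫ z, f (x + h • z) * inner ℝ z v ∂unitSphereUniform d := by
    have hmp := measurePreserving_neg_unitSphereUniform (d := d)
    rw [← hmp.integral_comp (MeasurableEquiv.neg E).measurableEmbedding
      (fun z => f (x + h • z) * inner ℝ z v), ← integral_neg]
    simp [sub_eq_add_neg]
  simp only [queryDifference, sub_mul]
  rw [integral_sub, h1]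
  · ring
  · exact Continuous.integrable_unitSphereUniform (by fun_prop)
  · exact Continuous.integrable_unitSphereUniform (by fun_prop)

end Difference

/-! ### Elementary sums and the telescoping of the recursion. -/

section Sums

theorem sum_inv_sqrt_le (n : ℕ) : ∑ t ∈ Finset.Icc 1 n, 1 / √(t : ℝ) ≤ 2 * √(n : ℝ) := by
  induction n with
  | zero => simp
  | succ n ih =>
    rw [Finset.sum_Icc_succ_top (by omega)]
    have h1 : 0 ≤ √(n : ℝ) := Real.sqrt_nonneg _
    have h2 : 0 < √((n + 1 : ℕ) : ℝ) := Real.sqrt_pos.2 (by positivity)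
    have h3 : √(n : ℝ) ^ 2 = n := Real.sq_sqrt (by positivity)
    have h4 : √((n + 1 : ℕ) : ℝ) ^ 2 = n + 1 := by
      rw [Real.sq_sqrt (by positivity)]; push_cast; ring
    have h5 : 1 / √((n + 1 : ℕ) : ℝ) ≤ 2 * √((n + 1 : ℕ) : ℝ) - 2 * √(n : ℝ) := by
      rw [div_le_iff₀ h2]
      nlinarith [sq_nonneg (√((n + 1 : ℕ) : ℝ) - √(n : ℝ))]
    linarith

theorem sum_inv_le_one_add_log (n : ℕ) :
    ∑ t ∈ Finset.Icc 1 n, 1 / (t : ℝ) ≤ 1 + Real.log n := by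
  have := harmonic_le_one_add_log n
  rw [harmonic_eq_sum_Icc] at this
  push_cast at this
  simpa using this

/-- The a-terms equal (α/2)((t - 1)a_t - t a_{t+1}): they telescope, the coefficient of a_1 is zero,
and the last term has the right sign. -/
theorem sum_le_sum_of_step {α : ℝ} (hα : 0 ≤ α) {a R e : ℕ → ℝ} (ha : ∀ t, 0 ≤ a t) (T : ℕ)
    (h : ∀ t ∈ Finset.Icc 1 T, R t ≤ α * t / 2 * (a t - a (t + 1)) - α / 2 * a t + e t) :
    ∑ t ∈ Finset.Icc 1 T, R t ≤ ∑ t ∈ Finset.Icc 1 T, e t := by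
  have key : ∀ n ≤ T, ∑ t ∈ Finset.Icc 1 n, R t ≤
      ∑ t ∈ Finset.Icc 1 n, e t - α / 2 * n * a (n + 1) := by
    intro n
    induction n with
    | zero => simp
    | succ n ih =>
      intro hn
      rw [Finset.sum_Icc_succ_top (by omega), Finset.sum_Icc_succ_top (by omega)]
      have h1 := ih (by omega)
      have h2 := h (n + 1) (Finset.mem_Icc.2 ⟨by omega, hn⟩)
      push_cast at h2 ⊢
      linarith
  have := key T le_rfl
  have h2 : 0 ≤ α / 2 * T * a (T + 1) := mul_nonneg (by positivity) (ha _)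
  linarith

end Sums

/-! ### One step in expectation. -/

section Step

variable {d : ℕ} {Ω : Type*} [MeasurableSpace Ω] {μ : Measure Ω} [IsProbabilityMeasure μ]

local notation "E" => EuclideanSpace ℝ (Fin d)

theorem integrable_of_mem_compact {Θ : Set E} (hc : IsCompact Θ) {X : Ω → E} (hX : Measurable X)
    (hmem : ∀ ω, X ω ∈ Θ) {g : E → ℝ} (hg : Continuous g) : Integrable (fun ω => g (X ω)) μ := by
  obtain ⟨M, hM⟩ := hc.exists_bound_of_continuousOn hg.continuousOn
  exact (integrable_const M).mono' (hg.measurable.comp hX).aestronglyMeasurable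
    (ae_of_all _ fun ω => hM _ (hmem ω))

/-- The cross terms of Δ with each noise vanish, and (ξ - ξ')² ≤ 2ξ² + 2ξ'² needs nothing about the
joint law of the noises. -/
theorem integral_response_sq_le {Δ ξ ξ' : Ω → ℝ} {σ b M : ℝ} (hΔ : Measurable Δ)
    (hΔM : ∀ᵐ ω ∂μ, |Δ ω| ≤ M) (hξm : Measurable ξ) (hξm' : Measurable ξ')
    (hξ : Integrable (fun ω => ξ ω ^ 2) μ) (hξ' : Integrable (fun ω => ξ' ω ^ 2) μ)
    (hσ : ∫ ω, ξ ω ^ 2 ∂μ ≤ σ ^ 2) (hσ' : ∫ ω, ξ' ω ^ 2 ∂μ ≤ σ ^ 2)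
    (hb : ∫ ω, Δ ω ^ 2 ∂μ ≤ b) (h0 : ∫ ω, Δ ω * ξ ω ∂μ = 0) (h0' : ∫ ω, Δ ω * ξ' ω ∂μ = 0) :
    Integrable (fun ω => (Δ ω + ξ ω - ξ' ω) ^ 2) μ ∧
      ∫ ω, (Δ ω + ξ ω - ξ' ω) ^ 2 ∂μ ≤ b + 4 * σ ^ 2 := by
  have m0 : MemLp Δ 2 μ := MemLp.of_bound hΔ.aestronglyMeasurable M hΔM
  have m1 : MemLp ξ 2 μ := (memLp_two_iff_integrable_sq hξm.aestronglyMeasurable).2 hξ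
  have m2 : MemLp ξ' 2 μ := (memLp_two_iff_integrable_sq hξm'.aestronglyMeasurable).2 hξ'
  have hint : Integrable (fun ω => (Δ ω + ξ ω - ξ' ω) ^ 2) μ := ((m0.add m1).sub m2).integrable_sq
  have i1 : Integrable (fun ω => Δ ω * ξ ω) μ := m0.integrable_mul m1
  have i2 : Integrable (fun ω => Δ ω * ξ' ω) μ := m0.integrable_mul m2
  refine ⟨hint, ?_⟩
  have hle : ∫ ω, (Δ ω + ξ ω - ξ' ω) ^ 2 ∂μ ≤
      ∫ ω, ((Δ ω ^ 2 + (2 * (Δ ω * ξ ω) - 2 * (Δ ω * ξ' ω))) + (2 * ξ ω ^ 2 + 2 * ξ' ω ^ 2)) ∂μ := by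
    refine integral_mono hint ((m0.integrable_sq.add ((i1.const_mul 2).sub (i2.const_mul 2))).add
      ((hξ.const_mul 2).add (hξ'.const_mul 2))) fun ω => ?_
    simp only
    nlinarith [sq_nonneg (ξ ω + ξ' ω)]
  have i3 : Integrable (fun ω => 2 * (Δ ω * ξ ω) - 2 * (Δ ω * ξ' ω)) μ :=
    (i1.const_mul 2).sub (i2.const_mul 2)
  have i4 : Integrable (fun ω => Δ ω ^ 2 + (2 * (Δ ω * ξ ω) - 2 * (Δ ω * ξ' ω))) μ :=
    m0.integrable_sq.add i3
  have i5 : Integrable (fun ω => 2 * ξ ω ^ 2 + 2 * ξ' ω ^ 2) μ :=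
    (hξ.const_mul 2).add (hξ'.const_mul 2)
  rw [integral_add i4 i5, integral_add m0.integrable_sq i3,
    integral_sub (i1.const_mul 2) (i2.const_mul 2), integral_add (hξ.const_mul 2) (hξ'.const_mul 2),
    integral_const_mul, integral_const_mul, integral_const_mul, integral_const_mul, h0, h0'] at hle
  linarith

/-- One step of the projected gradient method, in expectation. -/
theorem integral_step_le [NeZero d] {α L h ρ σ η : ℝ} {G : ℝ≥0} {Θ : Set E} {f : E → ℝ}
    (hα : 0 ≤ α) (hL : 0 ≤ L) (hh : 0 < h) (hρ : h ≤ ρ) (hη : 0 < η)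
    (hΘ : Convex ℝ Θ) (hc : IsCompact Θ)
    (hf : IsSmoothStronglyConvex α L Θ (Metric.thickening ρ Θ) f)
    (hG : LipschitzOnWith G f (Metric.thickening ρ Θ))
    {X X' ζ : Ω → E} {ξ ξ' : Ω → ℝ} (hX : Measurable X) (hX' : Measurable X') (hζ : Measurable ζ)
    (hξm : Measurable ξ) (hξm' : Measurable ξ') (hmem : ∀ ω, X ω ∈ Θ)
    (hstep : ∀ ω, IsEuclideanProj Θ
      (X ω - η • gradEstimate f h (X ω) (ζ ω) (ξ ω) (ξ' ω)) (X' ω))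
    (hlaw : μ.map ζ = unitSphereUniform d)
    (hind : IndepFun ζ (fun ω => (X ω, ξ ω)) μ) (hind' : IndepFun ζ (fun ω => (X ω, ξ' ω)) μ)
    (hξ : Integrable (fun ω => ξ ω ^ 2) μ) (hξ' : Integrable (fun ω => ξ' ω ^ 2) μ)
    (hσ : ∫ ω, ξ ω ^ 2 ∂μ ≤ σ ^ 2) (hσ' : ∫ ω, ξ' ω ^ 2 ∂μ ≤ σ ^ 2) {p : E} (hp : p ∈ Θ) :
    ∫ ω, (f (X ω) - f p) ∂μ ≤
      1 / (2 * η) * ((∫ ω, ‖X ω - p‖ ^ 2 ∂μ) - ∫ ω, ‖X' ω - p‖ ^ 2 ∂μ) -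
        α / 2 * (∫ ω, ‖X ω - p‖ ^ 2 ∂μ) +
        (L * h ^ 2 + η / 2 * (9 * Real.pi ^ 2 / 4 * G ^ 2 * d + d ^ 2 * σ ^ 2 / h ^ 2)) := by
  have hd : (0 : ℝ) < d := by exact_mod_cast NeZero.pos d
  have hfc := hf.differentiable.continuous
  have hfm := hfc.measurable
  have hball : ∀ ω, LipschitzOnWith G f (Metric.closedBall (X ω) h) := fun ω =>
    lipschitzOnWith_closedBall_of_thickening hfc hG hh.ne' hρ (hmem ω)
  have hnorm : ∀ᵐ ω ∂μ, ‖ζ ω‖ = 1 := by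
    have := ae_norm_eq_one_unitSphereUniform (d := d)
    rw [← hlaw] at this
    exact ae_of_ae_map hζ.aemeasurable this
  have hmemX' : ∀ ω, X' ω ∈ Θ := fun ω => (hstep ω).1
  have hindX : IndepFun ζ X μ := hind.comp measurable_id measurable_fst
  have hqm : Measurable fun q : E × E => queryDifference f h q.1 q.2 :=
    (continuous_queryDifference hfc h).measurable
  set Δ : Ω → ℝ := fun ω => queryDifference f h (X ω) (ζ ω) with hΔdef
  have hΔ : Measurable Δ := hqm.comp (hX.prodMk hζ)
  have hΔM : ∀ᵐ ω ∂μ, |Δ ω| ≤ 2 * h * G := by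
    filter_upwards [hnorm] with ω hω
    exact abs_queryDifference_le hh.le (hball ω) hω
  -- second moment of the noiseless difference
  have hΔsq : ∫ ω, Δ ω ^ 2 ∂μ ≤ 9 * Real.pi ^ 2 * (h * G) ^ 2 / d := by
    have hi : Integrable (fun ω => -Δ ω ^ 2) μ :=
      (MemLp.of_bound hΔ.aestronglyMeasurable _ hΔM : MemLp Δ 2 μ).integrable_sq.neg
    -- The averaging lemma gives lower bounds, so it is applied to the negated square.
    have h1 := integral_le_integral_of_le_integral_direction hζ hX hlaw hindX
      (k := fun q => -queryDifference f h q.2 q.1 ^ 2)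
      (((hqm.comp measurable_swap).pow_const 2).neg) hi
      (integrable_const (-(9 * Real.pi ^ 2 * (h * G) ^ 2 / d))) fun ω => by
        simp only [integral_neg]
        exact neg_le_neg (integral_queryDifference_sq_le hh.le hf.differentiable (hball ω))
    simp only [integral_neg, integral_const, probReal_univ, one_smul] at h1
    exact neg_le_neg_iff.1 h1
  have hΔξ : ∀ {n : Ω → ℝ}, Measurable n → IndepFun ζ (fun ω => (X ω, n ω)) μ →
      ∫ ω, Δ ω * n ω ∂μ = 0 := fun hn hi =>
    integral_eq_zero_of_odd hζ (hX.prodMk hn) hlaw hi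
      (k := fun q => queryDifference f h q.2.1 q.1 * q.2.2)
      ((hqm.comp (measurable_snd.fst.prodMk measurable_fst)).mul measurable_snd.snd)
      fun z w => by simp only [queryDifference_neg, neg_mul]
  obtain ⟨hYint, hY⟩ := integral_response_sq_le hΔ hΔM hξm hξm' hξ hξ' hσ hσ' hΔsq
    (hΔξ hξm hind) (hΔξ hξm' hind')
  -- first moment
  set I : Ω → ℝ := fun ω => inner ℝ (ζ ω) (X ω - p) with hI
  have hIm : Measurable I := by fun_prop
  obtain ⟨M, hM⟩ := hc.exists_bound_of_continuousOn (f := fun y => y - p) (by fun_prop)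
  have hIM : ∀ᵐ ω ∂μ, ‖I ω‖ ≤ M := by
    filter_upwards [hnorm] with ω hω
    refine (norm_inner_le_norm _ _).trans ?_
    rw [hω, one_mul]
    exact hM _ (hmem ω)
  have hIξ : ∀ {n : Ω → ℝ}, Measurable n → IndepFun ζ (fun ω => (X ω, n ω)) μ →
      ∫ ω, n ω * I ω ∂μ = 0 := fun hn hi =>
    integral_eq_zero_of_odd hζ (hX.prodMk hn) hlaw hi
      (k := fun q => q.2.2 * inner ℝ q.1 (q.2.1 - p)) (by fun_prop)
      fun z w => by simp only [inner_neg_left, mul_neg]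
  have hξi : Integrable ξ μ :=
    ((memLp_two_iff_integrable_sq hξm.aestronglyMeasurable).2 hξ).integrable one_le_two
  have hξi' : Integrable ξ' μ :=
    ((memLp_two_iff_integrable_sq hξm'.aestronglyMeasurable).2 hξ').integrable one_le_two
  have hΔi : Integrable Δ μ := (integrable_const (2 * h * G)).mono' hΔ.aestronglyMeasurable hΔM
  have iξ : Integrable (fun ω => ξ ω * I ω) μ := hξi.mul_bdd hIm.aestronglyMeasurable hIM
  have iξ' : Integrable (fun ω => ξ' ω * I ω) μ := hξi'.mul_bdd hIm.aestronglyMeasurable hIM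
  have iΔ : Integrable (fun ω => Δ ω * I ω) μ := hΔi.mul_bdd hIm.aestronglyMeasurable hIM
  have iX : Integrable (fun ω => ‖X ω - p‖ ^ 2) μ :=
    integrable_of_mem_compact hc hX hmem (g := fun y => ‖y - p‖ ^ 2) (by fun_prop)
  have iX' : Integrable (fun ω => ‖X' ω - p‖ ^ 2) μ :=
    integrable_of_mem_compact hc hX' hmemX' (g := fun y => ‖y - p‖ ^ 2) (by fun_prop)
  have if0 : Integrable (fun ω => f (X ω) - f p) μ :=
    integrable_of_mem_compact hc hX hmem (g := fun y => f y - f p) (by fun_prop)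
  have hfirst : (∫ ω, (f (X ω) - f p) ∂μ) + α / 2 * (∫ ω, ‖X ω - p‖ ^ 2 ∂μ) - L * h ^ 2 ≤
      d / (2 * h) * ∫ ω, Δ ω * I ω ∂μ := by
    have h1 := integral_le_integral_of_le_integral_direction hζ hX hlaw hindX
      (k := fun q => d / (2 * h) * (queryDifference f h q.2 q.1 * inner ℝ q.1 (q.2 - p)))
      (((hqm.comp measurable_swap).mul (by fun_prop)).const_mul _) (iΔ.const_mul _)
      (m := fun ω => ((f (X ω) - f p) + α / 2 * ‖X ω - p‖ ^ 2) - L * h ^ 2)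
      ((if0.add (iX.const_mul _)).sub (integrable_const _)) fun ω => by
        simp only [integral_const_mul]
        rw [integral_queryDifference_mul_inner hfc]
        refine (le_integral_sphere_mul_inner hα hL hh hρ hf hp).trans (le_of_eq ?_)
        field_simp
    rw [integral_const_mul] at h1
    have i1 : Integrable (fun ω => (f (X ω) - f p) + α / 2 * ‖X ω - p‖ ^ 2) μ :=
      if0.add (iX.const_mul _)
    rw [integral_sub i1 (integrable_const _), integral_add if0 (iX.const_mul _),
      integral_const_mul, integral_const, probReal_univ, one_smul] at h1
    exact h1
  -- the projection step
  set c : ℝ := d / (2 * h) with hcdef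
  have hpt : ∀ᵐ ω ∂μ, ‖X' ω - p‖ ^ 2 ≤ ‖X ω - p‖ ^ 2 -
      2 * η * c * (Δ ω * I ω + ξ ω * I ω - ξ' ω * I ω) +
        η ^ 2 * c ^ 2 * (Δ ω + ξ ω - ξ' ω) ^ 2 := by
    filter_upwards [hnorm] with ω hω
    have h1 := norm_sub_sq_le_of_isEuclideanProj hΘ hp (hstep ω)
    have h2 : gradEstimate f h (X ω) (ζ ω) (ξ ω) (ξ' ω) = (c * (Δ ω + ξ ω - ξ' ω)) • ζ ω := by
      simp only [gradEstimate, hΔdef, queryDifference, hcdef]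
      congr 2
      ring
    rw [h2, inner_smul_left, norm_smul, hω, conj_trivial, mul_one, Real.norm_eq_abs, sq_abs] at h1
    refine h1.trans (le_of_eq ?_)
    simp only [hI]
    ring
  have i2 : Integrable (fun ω => Δ ω * I ω + ξ ω * I ω) μ := iΔ.add iξ
  have i3 : Integrable (fun ω => Δ ω * I ω + ξ ω * I ω - ξ' ω * I ω) μ := i2.sub iξ'
  have i4 : Integrable (fun ω => ‖X ω - p‖ ^ 2 -
      2 * η * c * (Δ ω * I ω + ξ ω * I ω - ξ' ω * I ω)) μ := iX.sub (i3.const_mul _)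
  have hint := integral_mono_ae iX' (i4.add (hYint.const_mul (η ^ 2 * c ^ 2))) hpt
  simp only [Pi.add_apply] at hint
  rw [integral_add i4 (hYint.const_mul _), integral_sub iX (i3.const_mul _), integral_const_mul,
    integral_const_mul, integral_sub i2 iξ', integral_add iΔ iξ, hIξ hξm hind, hIξ hξm' hind',
    add_zero, sub_zero] at hint
  set a := ∫ ω, ‖X ω - p‖ ^ 2 ∂μ
  set a' := ∫ ω, ‖X' ω - p‖ ^ 2 ∂μ
  set J := ∫ ω, Δ ω * I ω ∂μ
  have hsec : η ^ 2 * c ^ 2 * ∫ ω, (Δ ω + ξ ω - ξ' ω) ^ 2 ∂μ ≤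
      η ^ 2 * (9 * Real.pi ^ 2 / 4 * G ^ 2 * d + d ^ 2 * σ ^ 2 / h ^ 2) := by
    calc _ ≤ η ^ 2 * c ^ 2 * (9 * Real.pi ^ 2 * (h * G) ^ 2 / d + 4 * σ ^ 2) := by gcongr
      _ = _ := by rw [hcdef]; field_simp; ring
  set Q := 9 * Real.pi ^ 2 / 4 * (G : ℝ) ^ 2 * d + d ^ 2 * σ ^ 2 / h ^ 2
  have hfin : c * J ≤ 1 / (2 * η) * (a - a') + η / 2 * Q := by
    have h3 : 2 * η * (c * J) ≤ (a - a') + η ^ 2 * Q := by linarith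
    have h4 : 1 / (2 * η) * (a - a') + η / 2 * Q = ((a - a') + η ^ 2 * Q) / (2 * η) := by
      field_simp
    rw [h4, le_div_iff₀ (by positivity)]
    linarith
  linarith

end Step

/-! ### Regret bounds along a whole run. -/

section Run

variable {d : ℕ} {Ω : Type*} [MeasurableSpace Ω] {μ : Measure Ω}

variable {f : EuclideanSpace ℝ (Fin d) → ℝ}
  {Θ : Set (EuclideanSpace ℝ (Fin d))} {T : ℕ} {σ : ℝ} {h η : ℕ → ℝ}
  {x ζ : ℕ → Ω → EuclideanSpace ℝ (Fin d)} {ξ ξ' : ℕ → Ω → ℝ}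

theorem IsKernelFreeRun.mem (hrun : IsKernelFreeRun μ f Θ T σ h η x ζ ξ ξ') {t : ℕ}
    (ht : t ∈ Finset.Icc 1 (T + 1)) (ω : Ω) : x t ω ∈ Θ := by
  obtain ⟨h1, h2⟩ := Finset.mem_Icc.1 ht
  obtain ⟨s, rfl⟩ := Nat.exists_eq_add_of_le' h1
  rcases Nat.eq_zero_or_pos s with rfl | hs
  · exact hrun.init_mem ω
  · exact (hrun.step s (Finset.mem_Icc.2 ⟨hs, by omega⟩) ω).1

theorem IsKernelFreeRun.measurable_iterate (hrun : IsKernelFreeRun μ f Θ T σ h η x ζ ξ ξ')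
    (hΘ : Convex ℝ Θ) (hc : IsCompact Θ) (hne : Θ.Nonempty) (hf : Continuous f) (t : ℕ)
    (ht : t ≤ T) : Measurable (x (t + 1)) := by
  induction t with
  | zero => exact hrun.measurable_init
  | succ t ih =>
    have hmem : t + 1 ∈ Finset.Icc 1 T := Finset.mem_Icc.2 ⟨by omega, ht⟩
    have hx := ih (by omega)
    have hz := hrun.measurable_dir _ hmem
    obtain ⟨hn, hn'⟩ := hrun.measurable_noise _ hmem
    have hfm := hf.measurable
    refine measurable_of_isEuclideanProj hΘ hc hne ?_ (hrun.step _ hmem)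
    unfold gradEstimate
    fun_prop

theorem cumulativeRegret_le [IsProbabilityMeasure μ] [NeZero d] {α L ρ : ℝ} {G : ℝ≥0}
    (hα : 0 < α) (hL : 0 ≤ L) (hh : ∀ t ∈ Finset.Icc 1 T, 0 < h t ∧ h t ≤ ρ)
    (hΘ : Convex ℝ Θ) (hc : IsCompact Θ)
    (hf : IsSmoothStronglyConvex α L Θ (Metric.thickening ρ Θ) f)
    (hG : LipschitzOnWith G f (Metric.thickening ρ Θ))
    (hrun : IsKernelFreeRun μ f Θ T σ h (stepSize α) x ζ ξ ξ') {p : EuclideanSpace ℝ (Fin d)} (hp : p ∈ Θ) :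
    cumulativeRegret μ f T x p ≤ ∑ t ∈ Finset.Icc 1 T, (L * h t ^ 2 +
      1 / (2 * α * t) * (9 * Real.pi ^ 2 / 4 * G ^ 2 * d + d ^ 2 * σ ^ 2 / h t ^ 2)) := by
  have hmeas : ∀ t ∈ Finset.Icc 1 (T + 1), Measurable (x t) := fun t ht => by
    obtain ⟨h1, h2⟩ := Finset.mem_Icc.1 ht
    obtain ⟨s, rfl⟩ := Nat.exists_eq_add_of_le' h1
    exact hrun.measurable_iterate hΘ hc ⟨p, hp⟩ hf.differentiable.continuous s (by omega)
  refine sum_le_sum_of_step hα.le (a := fun t => ∫ ω, ‖x t ω - p‖ ^ 2 ∂μ)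
    (fun t => integral_nonneg fun ω => sq_nonneg _) T fun t ht => ?_
  obtain ⟨h1, h2⟩ := Finset.mem_Icc.1 ht
  have ht1 : t ∈ Finset.Icc 1 (T + 1) := Finset.mem_Icc.2 ⟨h1, by omega⟩
  have ht2 : t + 1 ∈ Finset.Icc 1 (T + 1) := Finset.mem_Icc.2 ⟨by omega, by omega⟩
  have htpos : (0 : ℝ) < t := by exact_mod_cast h1
  obtain ⟨hht, hhρ⟩ := hh t ht
  have key := integral_step_le hα.le hL hht hhρ (show 0 < stepSize α t by
      unfold stepSize; positivity) hΘ hc hf hG (hmeas t ht1) (hmeas _ ht2)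
    (hrun.measurable_dir t ht) (hrun.measurable_noise t ht).1 (hrun.measurable_noise t ht).2
    (hrun.mem ht1) (hrun.step t ht) (hrun.law_dir t ht) (hrun.indep t ht) (hrun.indep' t ht)
    (hrun.noise_bound t ht).1 (hrun.noise_bound' t ht).1 (hrun.noise_bound t ht).2
    (hrun.noise_bound' t ht).2 hp
  refine key.trans (le_of_eq ?_)
  have e1 : 1 / (2 * stepSize α t) = α * t / 2 := by
    unfold stepSize; field_simp
  have e2 : stepSize α t / 2 = 1 / (2 * α * t) := by
    unfold stepSize; field_simp
  rw [e1, e2]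

theorem cumulativeRegret_le_diam [IsProbabilityMeasure μ] {ρ : ℝ} {G : ℝ≥0} (hρ : 0 < ρ)
    (hc : IsCompact Θ) (hG : LipschitzOnWith G f (Metric.thickening ρ Θ))
    (hrun : IsKernelFreeRun μ f Θ T σ h η x ζ ξ ξ') {p : EuclideanSpace ℝ (Fin d)} (hp : p ∈ Θ) :
    cumulativeRegret μ f T x p ≤ G * Metric.diam Θ * T := by
  have hsub := Metric.self_subset_thickening hρ Θ
  have : cumulativeRegret μ f T x p ≤ ∑ t ∈ Finset.Icc 1 T, G * Metric.diam Θ := by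
    refine Finset.sum_le_sum fun t ht => ?_
    obtain ⟨h1, h2⟩ := Finset.mem_Icc.1 ht
    have hmem := hrun.mem (Finset.mem_Icc.2 ⟨h1, by omega⟩ : t ∈ Finset.Icc 1 (T + 1))
    have hpt : ∀ ω, f (x t ω) - f p ≤ G * Metric.diam Θ := fun ω => by
      refine (le_abs_self _).trans ?_
      rw [← Real.dist_eq]
      refine (hG.dist_le_mul _ (hsub (hmem ω)) _ (hsub hp)).trans ?_
      gcongr
      exact Metric.dist_le_diam_of_mem hc.isBounded (hmem ω) hp
    by_cases hi : Integrable (fun ω => f (x t ω) - f p) μ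
    · simpa using integral_mono hi (integrable_const _) hpt
    -- A non-integrable term has integral 0 by convention, which is below the nonnegative bound.
    · rw [integral_undef hi]
      have := Metric.diam_nonneg (s := Θ)
      positivity
  refine this.trans (le_of_eq ?_)
  simp
  ring

end Run

/-! ### Choice of the perturbation sizes. -/

section Parameters

theorem perturbationSize_sq {d : ℕ} {σ L α : ℝ} (hL : 0 ≤ L) (hα : 0 ≤ α) (t : ℕ) :
    perturbationSize d σ L α t ^ 2 = √(3 * (d : ℝ) ^ 2 * σ ^ 2 / (4 * L * α * t)) := by
  rw [perturbationSize, ← Real.rpow_natCast, ← Real.rpow_mul (by positivity), Real.sqrt_eq_rpow]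
  norm_num

theorem perturbationSize_pos {d : ℕ} [NeZero d] {σ L α : ℝ} (hσ : 0 < σ) (hL : 0 < L) (hα : 0 < α)
    {t : ℕ} (ht : 1 ≤ t) : 0 < perturbationSize d σ L α t := by
  have hd : (0 : ℝ) < d := by exact_mod_cast NeZero.pos d
  have ht' : (0 : ℝ) < t := by exact_mod_cast ht
  unfold perturbationSize
  positivity

theorem perturbationSize_le {d : ℕ} {σ L α : ℝ} (hL : 0 < L) (hα : 0 < α)
    {t : ℕ} (ht : 1 ≤ t) : perturbationSize d σ L α t ≤ perturbationSize d σ L α 1 := by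
  have ht' : (1 : ℝ) ≤ t := by exact_mod_cast ht
  unfold perturbationSize
  refine Real.rpow_le_rpow (by positivity) ?_ (by norm_num)
  push_cast
  gcongr

/-- With q = h_t² the variance term is (2/3)Lq, so the left side is (5/3)Lq, while the right side is
exactly 2Lq. -/
theorem perturbation_tradeoff_le {d : ℕ} [NeZero d] {σ L α : ℝ} (hσ : 0 < σ) (hL : 0 < L)
    (hα : 0 < α) {t : ℕ} (ht : 1 ≤ t) :
    L * perturbationSize d σ L α t ^ 2 +
      1 / (2 * α * t) * (d ^ 2 * σ ^ 2 / perturbationSize d σ L α t ^ 2) ≤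
        √(3 * L) * σ * (d / √α) * (1 / √(t : ℝ)) := by
  have hd : (0 : ℝ) < d := by exact_mod_cast NeZero.pos d
  have ht' : (0 : ℝ) < t := by exact_mod_cast ht
  have hq0 : 0 < perturbationSize d σ L α t ^ 2 := pow_pos (perturbationSize_pos hσ hL hα ht) 2
  have hq := perturbationSize_sq (d := d) (σ := σ) hL.le hα.le t
  set q := perturbationSize d σ L α t ^ 2
  have hq2 : q ^ 2 = 3 * (d : ℝ) ^ 2 * σ ^ 2 / (4 * L * α * t) := by
    rw [hq, Real.sq_sqrt (by positivity)]
  have e1 : 1 / (2 * α * t) * (d ^ 2 * σ ^ 2 / q) = 2 / 3 * (L * q) := by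
    have : d ^ 2 * σ ^ 2 = 4 * L * α * t / 3 * q ^ 2 := by rw [hq2]; field_simp
    rw [this]
    field_simp
    ring
  have e2 : √(3 * L) * σ * (d / √α) * (1 / √(t : ℝ)) = 2 * (L * q) := by
    refine (sq_eq_sq₀ (by positivity) (by positivity)).1 ?_
    simp only [mul_pow, div_pow, hq2]
    rw [Real.sq_sqrt (by positivity), Real.sq_sqrt hα.le, Real.sq_sqrt ht'.le]
    field_simp
    norm_num
  rw [e1, e2]
  have : 0 < L * q := by positivity
  linarith

/-- With G = 0 the function is constant near p, and adding the convexity inequalities towards p + e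
and p - e cancels the gradient and leaves a positive quantity ≤ 0. This disposes of the case where
the noiseless bound has no room for the smoothing bias. -/
theorem not_isStronglyConvex_of_lipschitzOnWith_zero {d : ℕ} [NeZero d] {α ρ : ℝ}
    {Θ : Set (EuclideanSpace ℝ (Fin d))} {f : EuclideanSpace ℝ (Fin d) → ℝ} (hα : 0 < α)
    (hρ : 0 < ρ) (hG : LipschitzOnWith 0 f (Metric.thickening ρ Θ))
    {p : EuclideanSpace ℝ (Fin d)} (hp : p ∈ Θ) : ¬ IsStronglyConvex α f := by
  intro hf
  obtain ⟨e, he⟩ := exists_norm_eq (EuclideanSpace ℝ (Fin d)) (half_pos hρ).le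
  have hval : ∀ u : EuclideanSpace ℝ (Fin d), ‖u‖ < ρ → f (p + u) = f p := fun u hu => by
    have h := hG.dist_le_mul (p + u)
      (Metric.mem_thickening_iff.2 ⟨p, hp, by simpa [dist_eq_norm] using hu⟩) p
      (Metric.self_subset_thickening hρ Θ hp)
    exact dist_le_zero.1 (by simpa using h)
  have h1 := hf p (p + e)
  have h2 := hf p (p + -e)
  rw [hval e (by linarith), add_sub_cancel_left, sub_add_cancel_left, norm_neg, he] at h1
  rw [hval (-e) (by rw [norm_neg]; linarith), add_sub_cancel_left, sub_add_cancel_left,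
    inner_neg_right, neg_neg, he] at h2
  have : 0 < α / 2 * (ρ / 2) ^ 2 := by positivity
  linarith

end Parameters

/-! ### The two regret bounds. -/

theorem mainTheorem9 :
    ∃ C : ℝ, 0 < C ∧
      ∀ (d T : ℕ) (α L : ℝ) (G : ℝ≥0), 1 ≤ d → 2 ≤ T → 0 < α → 0 < L →
        (∀ (σ : ℝ) (Θ : Set (EuclideanSpace ℝ (Fin d))) (f : EuclideanSpace ℝ (Fin d) → ℝ),
          0 < σ → Convex ℝ Θ → IsCompact Θ →
          IsSmoothStronglyConvex α L Θ
            (Metric.thickening (perturbationSize d σ L α 1) Θ) f →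
          LipschitzOnWith G f (Metric.thickening (perturbationSize d σ L α 1) Θ) →
          ∀ (Ω : Type*) [MeasurableSpace Ω] (μ : Measure Ω) [IsProbabilityMeasure μ]
            (x ζ : ℕ → Ω → EuclideanSpace ℝ (Fin d)) (ξ ξ' : ℕ → Ω → ℝ),
            IsKernelFreeRun μ f Θ T σ (perturbationSize d σ L α) (stepSize α) x ζ ξ ξ' →
            ∀ p ∈ Θ, cumulativeRegret μ f T x p ≤
              min (G * Metric.diam Θ * T)
                (2 * √(3 * L) * σ * (d / √α) * √T
                  + C * (G : ℝ) ^ 2 / 2 * (d / α) * (1 + Real.log T))) ∧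
        (∃ hbar : ℝ, 0 < hbar ∧
          ∀ (ρ : ℝ) (h : ℕ → ℝ) (Θ : Set (EuclideanSpace ℝ (Fin d)))
            (f : EuclideanSpace ℝ (Fin d) → ℝ),
          ρ ≤ hbar → (∀ t ∈ Finset.Icc 1 T, 0 < h t ∧ h t ≤ ρ) →
          Convex ℝ Θ → IsCompact Θ →
          IsSmoothStronglyConvex α L Θ (Metric.thickening ρ Θ) f →
          LipschitzOnWith G f (Metric.thickening ρ Θ) →
          ∀ (Ω : Type*) [MeasurableSpace Ω] (μ : Measure Ω) [IsProbabilityMeasure μ]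
            (x ζ : ℕ → Ω → EuclideanSpace ℝ (Fin d)) (ξ ξ' : ℕ → Ω → ℝ),
            IsKernelFreeRun μ f Θ T 0 h (stepSize α) x ζ ξ ξ' →
            ∀ p ∈ Θ, cumulativeRegret μ f T x p ≤
              min (G * Metric.diam Θ * T)
                (C * (G : ℝ) ^ 2 * (d / α) * (1 + Real.log T))) := by
  have hpi := Real.pi_pos
  -- The factor 9π² comes from the Poincaré inequality (Lipschitz constant 3 of the extension, half
  -- turn of length π), and 1/4 from the square of d/(2h).
  refine ⟨9 * Real.pi ^ 2 / 4, by positivity, fun d T α L G hd hT hα hL => ?_⟩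
  have : NeZero d := ⟨by omega⟩
  have hd' : (0 : ℝ) < d := by exact_mod_cast NeZero.pos d
  have hT' : (0 : ℝ) < T := by exact_mod_cast (by omega : 0 < T)
  have hlog0 : 0 ≤ Real.log T := Real.log_natCast_nonneg T
  have hlog : ∑ t ∈ Finset.Icc 1 T, 1 / (2 * α * t) * (9 * Real.pi ^ 2 / 4 * (G : ℝ) ^ 2 * d) ≤
      9 * Real.pi ^ 2 / 4 * (G : ℝ) ^ 2 / 2 * (d / α) * (1 + Real.log T) := by
    calc _ = 9 * Real.pi ^ 2 / 4 * (G : ℝ) ^ 2 / 2 * (d / α) *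
          ∑ t ∈ Finset.Icc 1 T, 1 / (t : ℝ) := by
          rw [Finset.mul_sum]
          refine Finset.sum_congr rfl fun t ht => ?_
          have : (0 : ℝ) < t := by exact_mod_cast (Finset.mem_Icc.1 ht).1
          field_simp
      _ ≤ _ := mul_le_mul_of_nonneg_left (sum_inv_le_one_add_log T) (by positivity)
  refine ⟨?_, ?_⟩
  · intro σ Θ f hσ hΘ hc hf hG Ω _ μ _ x ζ ξ ξ' hrun p hp
    refine le_min (cumulativeRegret_le_diam (perturbationSize_pos hσ hL hα le_rfl) hc hG hrun hp) ?_
    refine (cumulativeRegret_le hα hL.le (fun t ht =>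
      ⟨perturbationSize_pos hσ hL hα (Finset.mem_Icc.1 ht).1,
        perturbationSize_le hL hα (Finset.mem_Icc.1 ht).1⟩) hΘ hc hf hG hrun hp).trans ?_
    have h1 : ∑ t ∈ Finset.Icc 1 T, (L * perturbationSize d σ L α t ^ 2 +
        1 / (2 * α * t) * (d ^ 2 * σ ^ 2 / perturbationSize d σ L α t ^ 2)) ≤
          2 * √(3 * L) * σ * (d / √α) * √T := by
      calc _ ≤ ∑ t ∈ Finset.Icc 1 T, √(3 * L) * σ * (d / √α) * (1 / √(t : ℝ)) :=
            Finset.sum_le_sum fun t ht =>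
              perturbation_tradeoff_le hσ hL hα (Finset.mem_Icc.1 ht).1
        _ ≤ √(3 * L) * σ * (d / √α) * (2 * √(T : ℝ)) := by
            rw [← Finset.mul_sum]
            exact mul_le_mul_of_nonneg_left (sum_inv_sqrt_le T) (by positivity)
        _ = _ := by ring
    refine le_trans (le_of_eq ?_) (add_le_add h1 hlog)
    rw [← Finset.sum_add_distrib]
    exact Finset.sum_congr rfl fun t _ => by ring
  · set b : ℝ := 9 * Real.pi ^ 2 / 4 * (G : ℝ) ^ 2 / 2 * (d / α) with hb
    -- Chosen so that T biases of size L h² add up to at most b, which doubles the logarithmic term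
    -- at worst. For G = 0 any positive value works, since no admissible f exists once Θ has a
    -- point.
    refine ⟨if G = 0 then 1 else √(b / (L * T)), ?_, ?_⟩
    · split_ifs with hG0
      · exact one_pos
      · have : (0 : ℝ) < G := by exact_mod_cast pos_iff_ne_zero.2 hG0
        positivity
    intro ρ h Θ f hρ hh hΘ hc hf hG Ω _ μ _ x ζ ξ ξ' hrun p hp
    have hρ0 : 0 < ρ := by
      have := hh 1 (Finset.mem_Icc.2 ⟨le_rfl, by omega⟩)
      exact this.1.trans_le this.2
    refine le_min (cumulativeRegret_le_diam hρ0 hc hG hrun hp) ?_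
    rcases eq_or_ne G 0 with rfl | hG0
    · exact absurd hf.strongly_convex (not_isStronglyConvex_of_lipschitzOnWith_zero hα hρ0 hG hp)
    rw [if_neg hG0] at hρ
    refine (cumulativeRegret_le hα hL.le hh hΘ hc hf hG hrun hp).trans ?_
    have hb0 : 0 ≤ b := by positivity
    have h1 : ∑ t ∈ Finset.Icc 1 T, L * h t ^ 2 ≤ b * (1 + Real.log T) := by
      calc _ ≤ ∑ t ∈ Finset.Icc 1 T, b / T := by
            refine Finset.sum_le_sum fun t ht => ?_
            have h2 : h t ^ 2 ≤ b / (L * T) := by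
              refine (Real.le_sqrt (hh t ht).1.le (by positivity)).1 ((hh t ht).2.trans hρ)
            calc L * h t ^ 2 ≤ L * (b / (L * T)) := by gcongr
              _ = b / T := by field_simp
        _ = b := by
            rw [Finset.sum_const, Nat.card_Icc, Nat.add_sub_cancel, nsmul_eq_mul]
            field_simp
        _ ≤ _ := le_mul_of_one_le_right hb0 (by linarith)
    refine le_trans (le_of_eq ?_) ((add_le_add h1 hlog).trans (le_of_eq ?_))
    · rw [← Finset.sum_add_distrib]
      exact Finset.sum_congr rfl fun t _ => by ring
    · rw [hb]
      ring
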